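/- Let $K$ be a field and $d$ a positive integer. If $\operatorname{char} K = p > 0$, write $d = d'i$ with $i$ a power of $p$ and $\gcd(d',p)=1$; if $\operatorname{char} K = 0$, put $d'=d$ and $i=1$. Assume that $K$ contains all $d'$-th roots of unity (that is, $X^{d'}-1$ splits into linear factors over $K$). Let $R = K[s,f,s_1,f_1,c_1,c_2,c_3,c_4,b_1,b_2,b_3,b_4]$ be the polynomial ring in $12$ variables, and let $J = J(1,d)$ be the first Mayr–Meyer ideal, generated by $s_1-sc_1$, $f_1-sc_4$, $c_j(s-fb_j^d)$ for $j=1,2,3,4$, $fc_1-sc_2$, $fc_4-sc_3$, $s(c_3-c_2)$, $f(c_2b_1-c_3b_4)$ and $fc_2(b_2-b_3)$. Then $$ \begin{aligned} J ={}& (s_1-sc_1,\ f_1-sc_4,\ c_1,\ c_2,\ c_3,\ c_4)\\ &\cap \bigcap_{\alpha} (s_1-sc_1,\ f_1-sc_4,\ c_4-c_1,\ c_3-c_2,\ c_1-c_2b_1^d,\ s-fb_1^d,\ b_1-b_4,\ b_2-b_3,\ b_1^i-\alpha b_2^i)\\ &\cap (s_1-sc_1,\ f_1-sc_4,\ s,\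 f)\\ &\cap (s_1-sc_1,\ f_1-sc_4,\ s,\ c_1,\ c_2,\ c_4,\ b_3^d,\ b_4)\\ &\cap (s_1-sc_1,\ f_1-sc_4,\ s,\ c_1,\ c_4,\ b_3^d,\ b_2-b_3,\ c_2b_1-c_3b_4)\\ &\cap (s_1-sc_1,\ f_1-sc_4,\ s^2,\ f^2,\ c_4(s-fb_4^d),\ c_3(s-fb_3^d),\ sc_3-fc_4,\ c_3^2,\ c_4^2,\ c_1-c_4,\ c_2-c_3,\ b_2-b_3,\ b_1-b_4), \end{aligned} $$ where $\alpha$ varies over the $d'$-th roots of unity in $K$, and this is a minimal primary decomposition of $J$: the ideals on the right are primary with pairwise distinct radicals, and none of them can be omitted. All components other than the last one are minimal components, i.e. their radicals are minimal primes of $J$, and there are exactly $d'+4$ of them. The last component is embedded, i.e. its radical is not a minimal prime of $J$; its radical is $(s_1-sc_1,\ f_1-sc_4,\ s,\ f,\ c_1,\ c_2,\ c_3,\ c_4,\ b_2-b_3,\ b_1-b_4)$. -/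

import Mathlib

namespace MayrMeyer

/-- The twelve indeterminates `s, f, s₁, f₁, c₁, …, c₄, b₁, …, b₄`. -/
inductive Var : Type
  | s | f | s₁ | f₁ | c₁ | c₂ | c₃ | c₄ | b₁ | b₂ | b₃ | b₄
  deriving DecidableEq

section Ideals

variable (K : Type*) [Field K]

/-- The polynomial ring `K[s, f, s₁, f₁, c₁, …, c₄, b₁, …, b₄]`. -/
abbrev PolyRing : Type _ := MvPolynomial Var K

variable {K}

noncomputable abbrev s : PolyRing K := MvPolynomial.X Var.s
noncomputable abbrev f : PolyRing K := MvPolynomial.X Var.f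
noncomputable abbrev s₁ : PolyRing K := MvPolynomial.X Var.s₁
noncomputable abbrev f₁ : PolyRing K := MvPolynomial.X Var.f₁
noncomputable abbrev c₁ : PolyRing K := MvPolynomial.X Var.c₁
noncomputable abbrev c₂ : PolyRing K := MvPolynomial.X Var.c₂
noncomputable abbrev c₃ : PolyRing K := MvPolynomial.X Var.c₃
noncomputable abbrev c₄ : PolyRing K := MvPolynomial.X Var.c₄
noncomputable abbrev b₁ : PolyRing K := MvPolynomial.X Var.b₁
noncomputable abbrev b₂ : PolyRing K := MvPolynomial.X Var.b₂
noncomputable abbrev b₃ : PolyRing K := MvPolynomial.X Var.b₃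
noncomputable abbrev b₄ : PolyRing K := MvPolynomial.X Var.b₄

variable (K)

/-- The first Mayr–Meyer ideal `J(1, d)`. -/
noncomputable def firstMayrMeyerIdeal (d : ℕ) : Ideal (PolyRing K) :=
  Ideal.span {s₁ - s * c₁, f₁ - s * c₄,
    c₁ * (s - f * b₁ ^ d), c₂ * (s - f * b₂ ^ d), c₃ * (s - f * b₃ ^ d), c₄ * (s - f * b₄ ^ d),
    f * c₁ - s * c₂, f * c₄ - s * c₃, s * (c₃ - c₂), f * (c₂ * b₁ - c₃ * b₄),
    f * c₂ * (b₂ - b₃)}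

/-- The component `(s₁ - sc₁, f₁ - sc₄, c₁, c₂, c₃, c₄)`. -/
noncomputable def compC : Ideal (PolyRing K) :=
  Ideal.span {s₁ - s * c₁, f₁ - s * c₄, c₁, c₂, c₃, c₄}

variable {K} in
/-- The component attached to a root of unity `α`. -/
noncomputable def compRoot (d i : ℕ) (α : K) : Ideal (PolyRing K) :=
  Ideal.span {s₁ - s * c₁, f₁ - s * c₄, c₄ - c₁, c₃ - c₂, c₁ - c₂ * b₁ ^ d, s - f * b₁ ^ d,
    b₁ - b₄, b₂ - b₃, b₁ ^ i - MvPolynomial.C α * b₂ ^ i}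

/-- The component `(s₁ - sc₁, f₁ - sc₄, s, f)`. -/
noncomputable def compSF : Ideal (PolyRing K) :=
  Ideal.span {s₁ - s * c₁, f₁ - s * c₄, s, f}

/-- The component `(s₁ - sc₁, f₁ - sc₄, s, c₁, c₂, c₄, b₃ᵈ, b₄)`. -/
noncomputable def compB₄ (d : ℕ) : Ideal (PolyRing K) :=
  Ideal.span {s₁ - s * c₁, f₁ - s * c₄, s, c₁, c₂, c₄, b₃ ^ d, b₄}

/-- The component `(s₁ - sc₁, f₁ - sc₄, s, c₁, c₄, b₃ᵈ, b₂ - b₃, c₂b₁ - c₃b₄)`. -/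
noncomputable def compQuadric (d : ℕ) : Ideal (PolyRing K) :=
  Ideal.span {s₁ - s * c₁, f₁ - s * c₄, s, c₁, c₄, b₃ ^ d, b₂ - b₃, c₂ * b₁ - c₃ * b₄}

/-- The embedded component. -/
noncomputable def compEmbedded (d : ℕ) : Ideal (PolyRing K) :=
  Ideal.span {s₁ - s * c₁, f₁ - s * c₄, s ^ 2, f ^ 2, c₄ * (s - f * b₄ ^ d),
    c₃ * (s - f * b₃ ^ d), s * c₃ - f * c₄, c₃ ^ 2, c₄ ^ 2,
    c₁ - c₄, c₂ - c₃, b₂ - b₃, b₁ - b₄}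

/-- The prime ideal `(s₁ - sc₁, f₁ - sc₄, s, f, c₁, …, c₄, b₂ - b₃, b₁ - b₄)`. -/
noncomputable def embeddedPrime : Ideal (PolyRing K) :=
  Ideal.span {s₁ - s * c₁, f₁ - s * c₄, s, f, c₁, c₂, c₃, c₄, b₂ - b₃, b₁ - b₄}

/-- The finite set of the components other than the embedded one, where `α` runs over
the `d'`-th roots of unity in `K`. -/
noncomputable def minimalComponents (d d' i : ℕ) : Finset (Ideal (PolyRing K)) :=
  (Polynomial.nthRootsFinset d' (1 : K)).image (compRoot d i) ∪
    {compC K, compSF K, compB₄ K d, compQuadric K d}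

end Ideals

end MayrMeyer

namespace MayrMeyer

open MvPolynomial (X C aeval)

variable {K : Type*} [Field K] {S : Type*} [CommRing S]

/-! Write J for the first Mayr–Meyer ideal. That J lies in every component is a check on generators.

For the reverse inclusion, an element x of the intersection is reduced modulo J, one component after
another shrinking what is left. Membership in `compC` and `compSF` gives x ∈ J + (fc₂, fc₃)
(`compC_inf_compSF_le`). Membership in `compQuadric` improves this to J + (sc₂, fc₃(b₂ - b₃))
(`mul_mem_of_mem_compQuadric`). `compB₄` absorbs the multiple of fc₃(b₂ - b₃) into J
(`mul_mem_of_mem_compB₄`). The root components together make the coefficient of sc₂ a multiple of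
b₁^d - b₂^d modulo (J : sc₂) (`mul_sub_aeval_substRoot_mem`, `b₁_pow_sub_b₂_pow_dvd`). Finally
`compEmbedded` puts the last cofactor into `embeddedPrime`, which multiplies sc₂(b₁^d - b₂^d) into J
(`mul_mem_of_mem_embeddedPrime`). Each cancellation of a coefficient uses that the component is
primary.

The components other than `compEmbedded` are kernels of substitutions into a domain, or preimages of
(π^n) for a prime element π. The embedded one is the kernel of a map to `EmbAlg`, free of rank 8
over a domain, in which every zero divisor is nilpotent.

Each non-embedded component has a K-point lying on no other component; this gives distinct radicals,
minimality of their primes and irredundancy. The embedded component is needed because sc₂(b₁^d -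
b₂^d) lies in all the others but not in it. -/

/-! ### Generators as relations in a quotient; J is contained in every component. -/

theorem firstMayrMeyerIdeal_le_ker_iff (g : PolyRing K →+* S) (d : ℕ) :
    firstMayrMeyerIdeal K d ≤ RingHom.ker g ↔
      g s₁ - g s * g c₁ = 0 ∧ g f₁ - g s * g c₄ = 0 ∧ g c₁ * (g s - g f * g b₁ ^ d) = 0 ∧
      g c₂ * (g s - g f * g b₂ ^ d) = 0 ∧ g c₃ * (g s - g f * g b₃ ^ d) = 0 ∧
      g c₄ * (g s - g f * g b₄ ^ d) = 0 ∧ g f * g c₁ - g s * g c₂ = 0 ∧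
      g f * g c₄ - g s * g c₃ = 0 ∧ g s * (g c₃ - g c₂) = 0 ∧
      g f * (g c₂ * g b₁ - g c₃ * g b₄) = 0 ∧ g f * g c₂ * (g b₂ - g b₃) = 0 := by
  simp only [firstMayrMeyerIdeal, Ideal.span_le, Set.insert_subset_iff, Set.singleton_subset_iff,
    SetLike.mem_coe, RingHom.mem_ker, map_sub, map_mul, map_pow]

theorem compC_le_ker_iff (g : PolyRing K →+* S) :
    compC K ≤ RingHom.ker g ↔
      g s₁ - g s * g c₁ = 0 ∧ g f₁ - g s * g c₄ = 0 ∧ g c₁ = 0 ∧ g c₂ = 0 ∧ g c₃ = 0 ∧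
      g c₄ = 0 := by
  simp only [compC, Ideal.span_le, Set.insert_subset_iff, Set.singleton_subset_iff,
    SetLike.mem_coe, RingHom.mem_ker, map_sub, map_mul]

theorem compRoot_le_ker_iff (g : PolyRing K →+* S) (d i : ℕ) (α : K) :
    compRoot d i α ≤ RingHom.ker g ↔
      g s₁ - g s * g c₁ = 0 ∧ g f₁ - g s * g c₄ = 0 ∧ g c₄ - g c₁ = 0 ∧ g c₃ - g c₂ = 0 ∧
      g c₁ - g c₂ * g b₁ ^ d = 0 ∧ g s - g f * g b₁ ^ d = 0 ∧ g b₁ - g b₄ = 0 ∧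
      g b₂ - g b₃ = 0 ∧ g b₁ ^ i - g (MvPolynomial.C α) * g b₂ ^ i = 0 := by
  simp only [compRoot, Ideal.span_le, Set.insert_subset_iff, Set.singleton_subset_iff,
    SetLike.mem_coe, RingHom.mem_ker, map_sub, map_mul, map_pow]

theorem compSF_le_ker_iff (g : PolyRing K →+* S) :
    compSF K ≤ RingHom.ker g ↔
      g s₁ - g s * g c₁ = 0 ∧ g f₁ - g s * g c₄ = 0 ∧ g s = 0 ∧ g f = 0 := by
  simp only [compSF, Ideal.span_le, Set.insert_subset_iff, Set.singleton_subset_iff,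
    SetLike.mem_coe, RingHom.mem_ker, map_sub, map_mul]

theorem compB₄_le_ker_iff (g : PolyRing K →+* S) (d : ℕ) :
    compB₄ K d ≤ RingHom.ker g ↔
      g s₁ - g s * g c₁ = 0 ∧ g f₁ - g s * g c₄ = 0 ∧ g s = 0 ∧ g c₁ = 0 ∧ g c₂ = 0 ∧
      g c₄ = 0 ∧ g b₃ ^ d = 0 ∧ g b₄ = 0 := by
  simp only [compB₄, Ideal.span_le, Set.insert_subset_iff, Set.singleton_subset_iff,
    SetLike.mem_coe, RingHom.mem_ker, map_sub, map_mul, map_pow]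

theorem compQuadric_le_ker_iff (g : PolyRing K →+* S) (d : ℕ) :
    compQuadric K d ≤ RingHom.ker g ↔
      g s₁ - g s * g c₁ = 0 ∧ g f₁ - g s * g c₄ = 0 ∧ g s = 0 ∧ g c₁ = 0 ∧ g c₄ = 0 ∧
      g b₃ ^ d = 0 ∧ g b₂ - g b₃ = 0 ∧ g c₂ * g b₁ - g c₃ * g b₄ = 0 := by
  simp only [compQuadric, Ideal.span_le, Set.insert_subset_iff, Set.singleton_subset_iff,
    SetLike.mem_coe, RingHom.mem_ker, map_sub, map_mul, map_pow]

theorem compEmbedded_le_ker_iff (g : PolyRing K →+* S) (d : ℕ) :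
    compEmbedded K d ≤ RingHom.ker g ↔
      g s₁ - g s * g c₁ = 0 ∧ g f₁ - g s * g c₄ = 0 ∧ g s ^ 2 = 0 ∧ g f ^ 2 = 0 ∧
      g c₄ * (g s - g f * g b₄ ^ d) = 0 ∧ g c₃ * (g s - g f * g b₃ ^ d) = 0 ∧
      g s * g c₃ - g f * g c₄ = 0 ∧ g c₃ ^ 2 = 0 ∧ g c₄ ^ 2 = 0 ∧
      g c₁ - g c₄ = 0 ∧ g c₂ - g c₃ = 0 ∧ g b₂ - g b₃ = 0 ∧ g b₁ - g b₄ = 0 := by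
  simp only [compEmbedded, Ideal.span_le, Set.insert_subset_iff, Set.singleton_subset_iff,
    SetLike.mem_coe, RingHom.mem_ker, map_sub, map_mul, map_pow]

theorem embeddedPrime_le_ker_iff (g : PolyRing K →+* S) :
    embeddedPrime K ≤ RingHom.ker g ↔
      g s₁ - g s * g c₁ = 0 ∧ g f₁ - g s * g c₄ = 0 ∧ g s = 0 ∧ g f = 0 ∧ g c₁ = 0 ∧
      g c₂ = 0 ∧ g c₃ = 0 ∧ g c₄ = 0 ∧ g b₂ - g b₃ = 0 ∧ g b₁ - g b₄ = 0 := by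
  simp only [embeddedPrime, Ideal.span_le, Set.insert_subset_iff, Set.singleton_subset_iff,
    SetLike.mem_coe, RingHom.mem_ker, map_sub, map_mul]

theorem firstMayrMeyerIdeal_le_compC (d : ℕ) : firstMayrMeyerIdeal K d ≤ compC K := by
  rw [← Ideal.mk_ker (I := compC K), firstMayrMeyerIdeal_le_ker_iff]
  obtain ⟨h1, h2, h3, h4, h5, h6⟩ := (compC_le_ker_iff _).1 (Ideal.mk_ker (I := compC K)).ge
  refine ⟨h1, h2, ?_⟩
  simp only [h3, h4, h5, h6]
  simp

theorem firstMayrMeyerIdeal_le_compSF (d : ℕ) : firstMayrMeyerIdeal K d ≤ compSF K := by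
  rw [← Ideal.mk_ker (I := compSF K), firstMayrMeyerIdeal_le_ker_iff]
  obtain ⟨h1, h2, h3, h4⟩ := (compSF_le_ker_iff _).1 (Ideal.mk_ker (I := compSF K)).ge
  refine ⟨h1, h2, ?_⟩
  simp only [h3, h4]
  simp

theorem firstMayrMeyerIdeal_le_compB₄ (d : ℕ) :
    firstMayrMeyerIdeal K d ≤ compB₄ K d := by
  rw [← Ideal.mk_ker (I := compB₄ K d), firstMayrMeyerIdeal_le_ker_iff]
  obtain ⟨h1, h2, h3, h4, h5, h6, h7, h8⟩ :=
    (compB₄_le_ker_iff _ _).1 (Ideal.mk_ker (I := compB₄ K d)).ge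
  refine ⟨h1, h2, ?_⟩
  simp only [h3, h4, h5, h6, h7, h8]
  simp

theorem firstMayrMeyerIdeal_le_compQuadric (d : ℕ) :
    firstMayrMeyerIdeal K d ≤ compQuadric K d := by
  rw [← Ideal.mk_ker (I := compQuadric K d), firstMayrMeyerIdeal_le_ker_iff]
  obtain ⟨h1, h2, h3, h4, h5, h6, h7, h8⟩ :=
    (compQuadric_le_ker_iff _ _).1 (Ideal.mk_ker (I := compQuadric K d)).ge
  refine ⟨h1, h2, ?_⟩
  rw [sub_eq_zero] at h7
  simp only [h3, h4, h5, h6, h7, h8]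
  simp

/-- Since α^d' = 1, b₁^d - b₂^d is a difference of d'-th powers of b₁^i and αb₂^i, hence divisible
by b₁^i - αb₂^i. -/
theorem b₁_pow_sub_b₂_pow_mem_compRoot {d d' i : ℕ} (hdi : d = d' * i) {α : K}
    (hα : α ^ d' = 1) : b₁ ^ d - b₂ ^ d ∈ compRoot d i α := by
  have h : b₁ ^ i - MvPolynomial.C α * b₂ ^ i ∈ compRoot d i α := Ideal.subset_span (by simp)
  have hpow (x : PolyRing K) : x ^ d = (x ^ i) ^ d' := by rw [← pow_mul, mul_comm i, ← hdi]
  have hd : b₁ ^ d - b₂ ^ d = (b₁ ^ i) ^ d' - (MvPolynomial.C α * b₂ ^ i : PolyRing K) ^ d' := by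
    rw [hpow, hpow, mul_pow, ← map_pow, hα, map_one, one_mul]
  rw [hd]
  exact Ideal.mem_of_dvd _ (sub_dvd_pow_sub_pow _ _ _) h

theorem firstMayrMeyerIdeal_le_compRoot {d d' i : ℕ} (hdi : d = d' * i) {α : K}
    (hα : α ^ d' = 1) : firstMayrMeyerIdeal K d ≤ compRoot d i α := by
  rw [← Ideal.mk_ker (I := compRoot d i α), firstMayrMeyerIdeal_le_ker_iff]
  obtain ⟨h1, h2, h3, h4, h5, h6, h7, h8, h9⟩ :=
    (compRoot_le_ker_iff _ _ _ _).1 (Ideal.mk_ker (I := compRoot d i α)).ge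
  have key := Ideal.Quotient.eq.2 (b₁_pow_sub_b₂_pow_mem_compRoot hdi hα)
  rw [map_pow, map_pow] at key
  refine ⟨h1, h2, ?_⟩
  rw [sub_eq_zero] at h3 h4 h5 h6 h7 h8
  rw [← h8, ← h7, h3, h4, h5, h6, ← key]
  refine ⟨?_, ?_, ?_, ?_, ?_, ?_, ?_, ?_, ?_⟩ <;> ring

theorem firstMayrMeyerIdeal_le_compEmbedded (d : ℕ) :
    firstMayrMeyerIdeal K d ≤ compEmbedded K d := by
  rw [← Ideal.mk_ker (I := compEmbedded K d), firstMayrMeyerIdeal_le_ker_iff]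
  obtain ⟨h1, h2, h3, h4, h5, h6, h7, h8, h9, h10, h11, h12, h13⟩ :=
    (compEmbedded_le_ker_iff _ _).1 (Ideal.mk_ker (I := compEmbedded K d)).ge
  refine ⟨h1, h2, ?_⟩
  rw [sub_eq_zero] at h10 h11 h12 h13
  rw [h10, h11, h12, h13]
  refine ⟨h5, h6, h6, h5, ?_, ?_, ?_, ?_, ?_⟩
  · linear_combination -h7
  · linear_combination -h7
  · ring
  · ring
  · ring

theorem compEmbedded_le_embeddedPrime (d : ℕ) : compEmbedded K d ≤ embeddedPrime K := by
  rw [← Ideal.mk_ker (I := embeddedPrime K), compEmbedded_le_ker_iff]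
  obtain ⟨h1, h2, h3, h4, h5, h6, h7, h8, h9, h10⟩ :=
    (embeddedPrime_le_ker_iff _).1 (Ideal.mk_ker (I := embeddedPrime K)).ge
  refine ⟨h1, h2, ?_⟩
  simp only [h3, h4, h5, h6, h7, h8, h9, h10]
  simp

theorem compSF_le_embeddedPrime : compSF K ≤ embeddedPrime K := by
  rw [← Ideal.mk_ker (I := embeddedPrime K), compSF_le_ker_iff]
  obtain ⟨h1, h2, h3, h4, -⟩ :=
    (embeddedPrime_le_ker_iff _).1 (Ideal.mk_ker (I := embeddedPrime K)).ge
  exact ⟨h1, h2, h3, h4⟩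

/-! ### Identities modulo J. -/

/-- Relations in the quotient by the first Mayr–Meyer ideal. -/
theorem derived_relations {s f c₁ c₂ c₃ c₄ b₁ b₂ b₃ b₄ : S} {d : ℕ}
    (h3 : c₁ * (s - f * b₁ ^ d) = 0)
    (h4 : c₂ * (s - f * b₂ ^ d) = 0) (h5 : c₃ * (s - f * b₃ ^ d) = 0)
    (h6 : c₄ * (s - f * b₄ ^ d) = 0) (h7 : f * c₁ - s * c₂ = 0)
    (h8 : f * c₄ - s * c₃ = 0) (h9 : s * (c₃ - c₂) = 0)
    (h10 : f * (c₂ * b₁ - c₃ * b₄) = 0) (h11 : f * c₂ * (b₂ - b₃) = 0) :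
    s * c₁ = s * c₂ * b₁ ^ d ∧ s * c₃ = s * c₂ ∧ s * c₄ = s * c₂ * b₄ ^ d ∧ f * c₁ = s * c₂ ∧
    f * c₄ = s * c₂ ∧ f * c₂ * b₃ ^ d = s * c₂ ∧ f * c₃ * b₃ ^ d = s * c₂ ∧
    s * c₂ * b₂ = s * c₂ * b₃ ∧ s * c₂ * b₁ = s * c₂ * b₄ ∧ s * c₂ * b₁ ^ d = s * c₂ * b₄ ^ d ∧
    f * c₂ * b₂ ^ d = s * c₂ := by
  have pw : ∀ u x y : S, u * x = u * y → ∀ n : ℕ, u * x ^ n = u * y ^ n := by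
    intro u x y h n
    induction n with
    | zero => simp
    | succ n ih => linear_combination x * ih + y ^ n * h
  have e2 : f * c₂ * b₂ ^ d = s * c₂ := by linear_combination -h4
  have e23 := pw (f * c₂) b₂ b₃ (by linear_combination h11) d
  have t23 : s * c₂ * b₂ = s * c₂ * b₃ := by
    linear_combination (b₃ - b₂) * e2 + b₂ ^ d * h11
  -- The chain is sc₂b₁ = fc₂b₂^d b₁ = fc₂b₃^d b₁ = fc₃b₃^d b₄ = sc₃b₄ = sc₂b₄.
  have t14 : s * c₂ * b₁ = s * c₂ * b₄ := by
    linear_combination (- b₁) * e2 + b₁ * e23 + b₃ ^ d * h10 - b₄ * h5 + b₄ * h9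
  refine ⟨?_, ?_, ?_, ?_, ?_, ?_, ?_, t23, t14, pw _ _ _ t14 d, e2⟩
  · linear_combination h3 + b₁ ^ d * h7
  · linear_combination h9
  · linear_combination h6 + b₄ ^ d * h8 + b₄ ^ d * h9
  · linear_combination h7
  · linear_combination h8 + h9
  · linear_combination e2 - e23
  · linear_combination -h5 + h9

/-! ### Primality and primariness of the non-embedded components. -/

theorem isPrimary_comap_span_pow {R A : Type*} [CommRing R] [CommRing A] [IsDomain A]
    (ψ : R →+* A) {π : A} (hπ : Prime π) {n : ℕ} (hn : 0 < n) :
    (Ideal.comap ψ (Ideal.span {π ^ n})).IsPrimary := by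
  refine Ideal.IsPrimary.comap (Ideal.isPrimary_iff.2 ⟨?_, fun {x y} h => ?_⟩) ψ
  · rw [Ne, Ideal.span_singleton_eq_top]
    exact fun h => hπ.not_isUnit ((isUnit_pow_iff hn.ne').1 h)
  · rw [Ideal.mem_span_singleton] at h
    by_cases hy : π ∣ y
    · exact .inr ⟨n, Ideal.mem_span_singleton.2 (pow_dvd_pow_of_dvd hy n)⟩
    · exact .inl (Ideal.mem_span_singleton.2 (hπ.pow_dvd_of_dvd_mul_right n hy h))

/-- The map θ undoes ψ modulo I, so ψ x ∈ P ≤ ker θ forces x to vanish in R ⧸ I. This identifies an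
ideal given by generators with a preimage without computing the image of ψ. -/
theorem eq_comap_of_comp_eq_mk {R A : Type*} [CommRing R] [CommRing A] {I : Ideal R}
    {P : Ideal A} (ψ : R →+* A) (θ : A →+* R ⧸ I) (hθ : θ.comp ψ = Ideal.Quotient.mk I)
    (h₁ : I ≤ P.comap ψ) (h₂ : P ≤ RingHom.ker θ) : I = P.comap ψ := by
  refine le_antisymm h₁ fun x hx => Ideal.Quotient.eq_zero_iff_mem.1 ?_
  rw [← hθ]
  exact h₂ hx

/-- A substitution that moves each variable only within its class modulo I moves every polynomial
only within its class. -/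
theorem mk_comp_eq_mk {I : Ideal (PolyRing K)} (v : Var → PolyRing K)
    (h : ∀ x, Ideal.Quotient.mk I (v x) = Ideal.Quotient.mk I (X x)) :
    (Ideal.Quotient.mk I).comp (aeval v : PolyRing K →ₐ[K] PolyRing K).toRingHom =
      Ideal.Quotient.mk I := by
  have : (Ideal.Quotient.mkₐ K I).comp (aeval v) = Ideal.Quotient.mkₐ K I := by
    ext x
    simpa using h x
  exact congrArg AlgHom.toRingHom this

theorem eq_ker_aeval {I : Ideal (PolyRing K)} (v : Var → PolyRing K)
    (h : ∀ x, Ideal.Quotient.mk I (v x) = Ideal.Quotient.mk I (X x))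
    (hI : I ≤ RingHom.ker (aeval v : PolyRing K →ₐ[K] PolyRing K).toRingHom) :
    I = RingHom.ker (aeval v : PolyRing K →ₐ[K] PolyRing K).toRingHom :=
  eq_comap_of_comp_eq_mk _ _ (mk_comp_eq_mk v h) hI bot_le

/-- The substitution killing the variables `c_j`. -/
noncomputable def substC : Var → PolyRing K
  | .s => s | .f => f | .b₁ => b₁ | .b₂ => b₂ | .b₃ => b₃ | .b₄ => b₄
  | _ => 0

/-- The substitution killing `s` and `f`. -/
noncomputable def substSF : Var → PolyRing K
  | .c₁ => c₁ | .c₂ => c₂ | .c₃ => c₃ | .c₄ => c₄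
  | .b₁ => b₁ | .b₂ => b₂ | .b₃ => b₃ | .b₄ => b₄
  | _ => 0

/-- The substitution whose kernel is the embedded prime. -/
noncomputable def substEmbedded : Var → PolyRing K
  | .b₁ => b₄ | .b₂ => b₃ | .b₃ => b₃ | .b₄ => b₄
  | _ => 0

/-- The substitution given by the linear generators of `compB₄`. -/
noncomputable def substB₄ : Var → PolyRing K
  | .f => f | .c₃ => c₃ | .b₁ => b₁ | .b₂ => b₂ | .b₃ => b₃
  | _ => 0

/-- The substitution given by the generators of `compRoot` not involving the root of unity. -/
noncomputable def substRoot (d : ℕ) : Var → PolyRing K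
  | .s => f * b₁ ^ d | .f => f | .s₁ => f * b₁ ^ d * (c₂ * b₁ ^ d)
  | .f₁ => f * b₁ ^ d * (c₂ * b₁ ^ d)
  | .c₁ => c₂ * b₁ ^ d | .c₂ => c₂ | .c₃ => c₂ | .c₄ => c₂ * b₁ ^ d
  | .b₁ => b₁ | .b₂ => b₂ | .b₃ => b₂ | .b₄ => b₁

theorem compC_eq_ker :
    compC K = RingHom.ker (aeval substC : PolyRing K →ₐ[K] PolyRing K).toRingHom := by
  refine eq_ker_aeval _ ?_ ((compC_le_ker_iff _).2 (by simp [substC]))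
  obtain ⟨h1, h2, h3, h4, h5, h6⟩ := (compC_le_ker_iff _).1 (Ideal.mk_ker (I := compC K)).ge
  rw [h3, sub_eq_zero, mul_zero] at h1
  rw [h6, sub_eq_zero, mul_zero] at h2
  rintro (_ | _) <;> simp [substC, *]

theorem compSF_eq_ker :
    compSF K = RingHom.ker (aeval substSF : PolyRing K →ₐ[K] PolyRing K).toRingHom := by
  refine eq_ker_aeval _ ?_ ((compSF_le_ker_iff _).2 (by simp [substSF]))
  obtain ⟨h1, h2, h3, h4⟩ := (compSF_le_ker_iff _).1 (Ideal.mk_ker (I := compSF K)).ge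
  rw [h3, sub_eq_zero, zero_mul] at h1 h2
  rintro (_ | _) <;> simp [substSF, *]

theorem embeddedPrime_eq_ker :
    embeddedPrime K =
      RingHom.ker (aeval substEmbedded : PolyRing K →ₐ[K] PolyRing K).toRingHom := by
  refine eq_ker_aeval _ ?_ ((embeddedPrime_le_ker_iff _).2 (by simp [substEmbedded]))
  obtain ⟨h1, h2, h3, h4, h5, h6, h7, h8, h9, h10⟩ :=
    (embeddedPrime_le_ker_iff _).1 (Ideal.mk_ker (I := embeddedPrime K)).ge
  rw [h3, sub_eq_zero, zero_mul] at h1 h2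
  rw [sub_eq_zero] at h9 h10
  rintro (_ | _) <;> simp [substEmbedded, *]

theorem compC_isPrime : (compC K).IsPrime := compC_eq_ker (K := K) ▸ RingHom.ker_isPrime _

theorem compSF_isPrime : (compSF K).IsPrime := compSF_eq_ker (K := K) ▸ RingHom.ker_isPrime _

theorem embeddedPrime_isPrime : (embeddedPrime K).IsPrime :=
  embeddedPrime_eq_ker (K := K) ▸ RingHom.ker_isPrime _

theorem compB₄_isPrimary {d : ℕ} (hd : 0 < d) : (compB₄ K d).IsPrimary := by
  have : compB₄ K d = Ideal.comap (aeval substB₄ : PolyRing K →ₐ[K] PolyRing K).toRingHom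
      (Ideal.span {b₃ ^ d}) := by
    obtain ⟨h1, h2, h3, h4, h5, h6, h7, h8⟩ :=
      (compB₄_le_ker_iff _ _).1 (Ideal.mk_ker (I := compB₄ K d)).ge
    rw [h3, sub_eq_zero, zero_mul] at h1 h2
    refine eq_comap_of_comp_eq_mk _ _ (mk_comp_eq_mk _ ?_) ?_ ?_
    · rintro (_ | _) <;> simp [substB₄, *]
    · rw [← Ideal.mk_ker (I := Ideal.span _), RingHom.comap_ker, compB₄_le_ker_iff]
      simp [substB₄, ← map_pow]
    · rw [Ideal.span_singleton_le_iff_mem, RingHom.mem_ker, map_pow]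
      exact h7
  rw [this]
  exact isPrimary_comap_span_pow _ MvPolynomial.X_prime hd

theorem compRoot_eq_comap (d i : ℕ) (α : K) :
    compRoot d i α = Ideal.comap (aeval (substRoot d) : PolyRing K →ₐ[K] PolyRing K).toRingHom
      (Ideal.span {b₁ ^ i - C α * b₂ ^ i}) := by
  obtain ⟨h1, h2, h3, h4, h5, h6, h7, h8, h9⟩ :=
    (compRoot_le_ker_iff _ _ _ _).1 (Ideal.mk_ker (I := compRoot d i α)).ge
  rw [sub_eq_zero] at h1 h2 h3 h4 h5 h6 h7 h8
  refine eq_comap_of_comp_eq_mk _ _ (mk_comp_eq_mk _ ?_) ?_ ?_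
  · rintro (_ | _) <;> simp [substRoot, *]
  · rw [← Ideal.mk_ker (I := Ideal.span _), RingHom.comap_ker, compRoot_le_ker_iff]
    simp only [RingHom.comp_apply, AlgHom.toRingHom_eq_coe, RingHom.coe_coe, MvPolynomial.aeval_X,
      substRoot, ← map_sub, ← map_mul, ← map_pow, MvPolynomial.algHom_C, sub_self, true_and, Ideal.Quotient.eq_zero_iff_mem]
    simp
  · rw [Ideal.span_singleton_le_iff_mem, RingHom.mem_ker, map_sub, map_mul, map_pow, map_pow]
    exact h9

theorem prime_X_sub_C_mul_X (β : K) : Prime (b₁ - C β * b₂ : PolyRing K) := by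
  refine Irreducible.prime ?_
  have := MvPolynomial.irreducible_mul_X_add (1 : PolyRing K) (-(C β * b₂)) Var.b₁ one_ne_zero
    (by simp) (fun h => ?_) isRelPrime_one_left
  · simpa [sub_eq_add_neg] using this
  · rw [MvPolynomial.vars_neg] at h
    have := MvPolynomial.vars_mul _ _ h
    simp at this

/-- By Frobenius, b₁^(p^e) - β^(p^e) b₂^(p^e) = (b₁ - βb₂)^(p^e), a power of a prime element. In
characteristic 0 the exponential characteristic is 1 and the exponent is trivial. -/
theorem compRoot_isPrimary {p e d : ℕ} [ExpChar K p] (β : K) :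
    (compRoot d (p ^ e) (β ^ p ^ e)).IsPrimary := by
  have : ExpChar (PolyRing K) p := expChar_of_injective_ringHom (MvPolynomial.C_injective _ _) p
  rw [compRoot_eq_comap, map_pow, ← mul_pow, ← sub_pow_expChar_pow]
  exact isPrimary_comap_span_pow _ (prime_X_sub_C_mul_X β) (pow_pos (expChar_pos K p) e)

/-- The polynomial has degree one in b₁, with leading coefficient c₂ coprime to c₃b₄. -/
theorem prime_quadric : Prime (c₂ * b₁ - c₃ * b₄ : PolyRing K) := by
  refine Irreducible.prime ?_
  have := MvPolynomial.irreducible_mul_X_add (c₂ : PolyRing K) (-(c₃ * b₄)) Var.b₁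
    (MvPolynomial.X_ne_zero _) (by simp) (fun h => ?_) ?_
  · simpa [sub_eq_add_neg] using this
  · rw [MvPolynomial.vars_neg] at h
    have := MvPolynomial.vars_mul _ _ h
    simp at this
  · rw [IsRelPrime.neg_right_iff]
    refine (MvPolynomial.X_prime.irreducible.isRelPrime_iff_not_dvd).2 fun h => ?_
    have h2 := map_dvd (MvPolynomial.eval (fun v : Var => if v = .c₂ then (0 : K) else 1)) h
    simp at h2

/-- The map to a polynomial ring in `b₂ = b₃` over a `K`-algebra `D` receiving the other
variables. -/
noncomputable def quadricVar {D : Type*} [CommRing D] [Algebra K D] (m : PolyRing K →ₐ[K] D) :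
    Var → Polynomial D
  | .f => Polynomial.C (m f) | .c₂ => Polynomial.C (m c₂) | .c₃ => Polynomial.C (m c₃)
  | .b₁ => Polynomial.C (m b₁) | .b₄ => Polynomial.C (m b₄)
  | .b₂ => Polynomial.X | .b₃ => Polynomial.X
  | _ => 0

/-- The component is the preimage of (T^d) in D[T], where T is the common image of b₂ and b₃; the
return map sends T to the class of b₃. In the application D is the polynomial ring modulo the prime
c₂b₁ - c₃b₄. -/
theorem compQuadric_isPrimary_of_domain {D : Type*} [CommRing D] [IsDomain D] [Algebra K D]
    {d : ℕ} (hd : 0 < d) (m : PolyRing K →ₐ[K] D) (hm : m c₂ * m b₁ = m c₃ * m b₄)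
    (κ : D →+* PolyRing K ⧸ compQuadric K d) (hκ : ∀ x, κ (m x) = Ideal.Quotient.mk _ x) :
    (compQuadric K d).IsPrimary := by
  obtain ⟨h1, h2, h3, h4, h5, h6, h7, h8⟩ :=
    (compQuadric_le_ker_iff _ _).1 (Ideal.mk_ker (I := compQuadric K d)).ge
  rw [h3, sub_eq_zero, zero_mul] at h1 h2
  rw [sub_eq_zero] at h7
  have : compQuadric K d = Ideal.comap (aeval (quadricVar m) : PolyRing K →ₐ[K] _).toRingHom
      (Ideal.span {Polynomial.X ^ d}) := by
    refine eq_comap_of_comp_eq_mk _ (Polynomial.eval₂RingHom κ (Ideal.Quotient.mk _ b₃))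
      ?_ ?_ ?_
    · refine MvPolynomial.ringHom_ext (fun r => ?_) ?_
      · have := hκ (C r)
        rw [MvPolynomial.algHom_C] at this
        simpa [Polynomial.algebraMap_apply] using this
      · rintro (_ | _) <;> simp [quadricVar, *]
    · rw [← Ideal.mk_ker (I := Ideal.span _), RingHom.comap_ker, compQuadric_le_ker_iff]
      simp [quadricVar, ← map_mul, hm, ← map_pow]
    · rw [Ideal.span_singleton_le_iff_mem, RingHom.mem_ker, map_pow]
      simpa using h6
  rw [this]
  exact isPrimary_comap_span_pow _ Polynomial.prime_X hd

theorem compQuadric_isPrimary {d : ℕ} (hd : 0 < d) : (compQuadric K d).IsPrimary := by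
  let q : Ideal (PolyRing K) := Ideal.span {c₂ * b₁ - c₃ * b₄}
  have hq : q.IsPrime := (Ideal.span_singleton_prime prime_quadric.ne_zero).2 prime_quadric
  have hqle : q ≤ compQuadric K d :=
    (Ideal.span_singleton_le_iff_mem _).2 (Ideal.subset_span (by simp))
  refine compQuadric_isPrimary_of_domain (D := PolyRing K ⧸ q) hd (Ideal.Quotient.mkₐ K q) ?_
    (Ideal.Quotient.factor hqle) fun x => by simp
  rw [← sub_eq_zero, ← map_mul, ← map_mul, ← map_sub]
  exact Ideal.Quotient.eq_zero_iff_mem.2 (Ideal.mem_span_singleton_self _)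

/-! ### The embedded component as the kernel of a map to a rank 8 algebra. -/

/-- The free `B`-algebra with basis `1, s, f, c, e, sf, fc, ce` in which `s² = f² = c² = e² = 0`,
`fe = sc = x fc`, `se = xy fc` and all products of three of `s, f, c, e` vanish. -/
@[ext]
structure EmbAlg {B : Type*} (x y : B) where
  /-- The coefficient of `1`. -/
  one : B
  /-- The coefficient of `s`. -/
  s : B
  /-- The coefficient of `f`. -/
  f : B
  /-- The coefficient of `c`. -/
  c : B
  /-- The coefficient of `e`. -/
  e : B
  /-- The coefficient of `sf`. -/
  sf : B
  /-- The coefficient of `fc`. -/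
  fc : B
  /-- The coefficient of `ce`. -/
  ce : B

namespace EmbAlg

variable {B : Type*} [CommRing B] {x y : B}

instance : Zero (EmbAlg x y) := ⟨⟨0, 0, 0, 0, 0, 0, 0, 0⟩⟩
instance : One (EmbAlg x y) := ⟨⟨1, 0, 0, 0, 0, 0, 0, 0⟩⟩
instance : Add (EmbAlg x y) := ⟨fun p q => ⟨p.one + q.one, p.s + q.s, p.f + q.f, p.c + q.c,
  p.e + q.e, p.sf + q.sf, p.fc + q.fc, p.ce + q.ce⟩⟩
instance : Neg (EmbAlg x y) := ⟨fun p => ⟨-p.one, -p.s, -p.f, -p.c, -p.e, -p.sf, -p.fc, -p.ce⟩⟩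
instance : Mul (EmbAlg x y) := ⟨fun p q => ⟨p.one * q.one, p.one * q.s + p.s * q.one,
  p.one * q.f + p.f * q.one, p.one * q.c + p.c * q.one, p.one * q.e + p.e * q.one,
  p.one * q.sf + p.sf * q.one + p.s * q.f + p.f * q.s,
  p.one * q.fc + p.fc * q.one + (p.f * q.c + p.c * q.f) + x * (p.f * q.e + p.e * q.f) +
    x * (p.s * q.c + p.c * q.s) + x * y * (p.s * q.e + p.e * q.s),
  p.one * q.ce + p.ce * q.one + p.c * q.e + p.e * q.c⟩⟩

theorem zero_def : (0 : EmbAlg x y) = ⟨0, 0, 0, 0, 0, 0, 0, 0⟩ := rfl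
theorem one_def : (1 : EmbAlg x y) = ⟨1, 0, 0, 0, 0, 0, 0, 0⟩ := rfl
theorem add_def (p q : EmbAlg x y) : p + q = ⟨p.one + q.one, p.s + q.s, p.f + q.f, p.c + q.c,
  p.e + q.e, p.sf + q.sf, p.fc + q.fc, p.ce + q.ce⟩ := rfl
theorem neg_def (p : EmbAlg x y) :
    -p = ⟨-p.one, -p.s, -p.f, -p.c, -p.e, -p.sf, -p.fc, -p.ce⟩ := rfl
theorem mul_def (p q : EmbAlg x y) : p * q = ⟨p.one * q.one, p.one * q.s + p.s * q.one,
  p.one * q.f + p.f * q.one, p.one * q.c + p.c * q.one, p.one * q.e + p.e * q.one,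
  p.one * q.sf + p.sf * q.one + p.s * q.f + p.f * q.s,
  p.one * q.fc + p.fc * q.one + (p.f * q.c + p.c * q.f) + x * (p.f * q.e + p.e * q.f) +
    x * (p.s * q.c + p.c * q.s) + x * y * (p.s * q.e + p.e * q.s),
  p.one * q.ce + p.ce * q.one + p.c * q.e + p.e * q.c⟩ := rfl

instance : CommRing (EmbAlg x y) where
  add_assoc p q r := by ext <;> simp only [add_def] <;> ring
  zero_add p := by ext <;> simp only [add_def, zero_def] <;> ring
  add_zero p := by ext <;> simp only [add_def, zero_def] <;> ring
  add_comm p q := by ext <;> simp only [add_def] <;> ring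
  neg_add_cancel p := by ext <;> simp only [add_def, neg_def, zero_def] <;> ring
  mul_assoc p q r := by ext <;> simp only [mul_def] <;> ring
  one_mul p := by ext <;> simp only [mul_def, one_def] <;> ring
  mul_one p := by ext <;> simp only [mul_def, one_def] <;> ring
  zero_mul p := by ext <;> simp only [mul_def, zero_def] <;> ring
  mul_zero p := by ext <;> simp only [mul_def, zero_def] <;> ring
  left_distrib p q r := by ext <;> simp only [mul_def, add_def] <;> ring
  right_distrib p q r := by ext <;> simp only [mul_def, add_def] <;> ring
  mul_comm p q := by ext <;> simp only [mul_def] <;> ring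
  nsmul := nsmulRec
  zsmul := zsmulRec

/-- The structure map of `EmbAlg x y`. -/
def ofBase (x y : B) : B →+* EmbAlg x y where
  toFun b := ⟨b, 0, 0, 0, 0, 0, 0, 0⟩
  map_one' := rfl
  map_zero' := rfl
  map_add' a b := by ext <;> simp [add_def]
  map_mul' a b := by ext <;> simp [mul_def]

theorem ofBase_apply (b : B) : ofBase x y b = ⟨b, 0, 0, 0, 0, 0, 0, 0⟩ := rfl

@[simp]
theorem mk_pow (b : B) (n : ℕ) :
    (⟨b, 0, 0, 0, 0, 0, 0, 0⟩ : EmbAlg x y) ^ n = ⟨b ^ n, 0, 0, 0, 0, 0, 0, 0⟩ :=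
  (map_pow (ofBase x y) b n).symm

theorem pow_three_eq_zero {p : EmbAlg x y} (hp : p.one = 0) : p ^ 3 = 0 := by
  rw [pow_three]
  ext <;> simp [mul_def, zero_def, hp]

/-- If the constant coefficient of q is nonzero, comparing coefficients of pq = 0 by increasing
degree kills p; if it is zero, q³ = 0. -/
theorem isPrimary_bot [IsDomain B] : (⊥ : Ideal (EmbAlg x y)).IsPrimary := by
  refine Ideal.isPrimary_iff.2 ⟨fun h => ?_, fun {p q} h => ?_⟩
  · rw [Ideal.eq_top_iff_one, Ideal.mem_bot] at h
    exact one_ne_zero (congrArg EmbAlg.one h)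
  · by_cases hq : q.one = 0
    · exact .inr ⟨3, pow_three_eq_zero hq⟩
    refine .inl ?_
    rw [Ideal.mem_bot, mul_def, zero_def] at h
    obtain ⟨h1, h2, h3, h4, h5, h6, h7, h8⟩ := EmbAlg.mk.inj h
    have h0 : p.one = 0 := (mul_eq_zero.1 h1).resolve_right hq
    simp only [h0, zero_mul, zero_add, mul_eq_zero, hq, or_false] at h2 h3 h4 h5
    simp only [h0, h2, h3, h4, h5, zero_mul, mul_zero, zero_add, add_zero, mul_eq_zero, hq,
      or_false] at h6 h7 h8
    exact EmbAlg.ext h0 h2 h3 h4 h5 h6 h7 h8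

end EmbAlg

/-- The coefficient ring of the algebra describing the embedded component. -/
abbrev EmbBase (K : Type*) [Field K] : Type _ := MvPolynomial Bool K

/-- The algebra containing the quotient by the embedded component. -/
abbrev EmbQuot (K : Type*) [Field K] (d : ℕ) : Type _ :=
  EmbAlg (X false ^ d : EmbBase K) (X true ^ d : EmbBase K)

/-- The images of the variables in `EmbQuot K d`. -/
noncomputable def embVar (d : ℕ) : Var → EmbQuot K d
  | .s => ⟨0, 1, 0, 0, 0, 0, 0, 0⟩
  | .f => ⟨0, 0, 1, 0, 0, 0, 0, 0⟩
  | .c₂ => ⟨0, 0, 0, 1, 0, 0, 0, 0⟩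
  | .c₃ => ⟨0, 0, 0, 1, 0, 0, 0, 0⟩
  | .c₁ => ⟨0, 0, 0, 0, 1, 0, 0, 0⟩
  | .c₄ => ⟨0, 0, 0, 0, 1, 0, 0, 0⟩
  -- Both s₁ and f₁ must go to se = xy fc, with x and y the d-th powers of the images of b₃ and b₄.
  | .s₁ => ⟨0, 0, 0, 0, 0, 0, X false ^ d * X true ^ d, 0⟩
  | .f₁ => ⟨0, 0, 0, 0, 0, 0, X false ^ d * X true ^ d, 0⟩
  | .b₂ => EmbAlg.ofBase _ _ (X false)
  | .b₃ => EmbAlg.ofBase _ _ (X false)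
  | .b₁ => EmbAlg.ofBase _ _ (X true)
  | .b₄ => EmbAlg.ofBase _ _ (X true)

/-- The map from the polynomial ring to `EmbQuot K d`. -/
noncomputable def embMap (K : Type*) [Field K] (d : ℕ) : PolyRing K →+* EmbQuot K d :=
  MvPolynomial.eval₂Hom ((EmbAlg.ofBase _ _).comp C) (embVar d)

/-- The embedding of the coefficient ring. -/
noncomputable def embBaseMap (K : Type*) [Field K] : EmbBase K →+* PolyRing K :=
  (aeval fun b => if b then b₄ else b₃ : EmbBase K →ₐ[K] PolyRing K).toRingHom

theorem embMap_X (d : ℕ) (v : Var) : embMap K d (X v) = embVar d v := by simp [embMap]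

theorem compEmbedded_le_ker_embMap (d : ℕ) :
    compEmbedded K d ≤ RingHom.ker (embMap K d) := by
  rw [compEmbedded_le_ker_iff]
  simp only [embMap_X, embVar, EmbAlg.ofBase_apply, EmbAlg.mk_pow, sub_eq_add_neg, pow_two]
  refine ⟨?_, ?_, ?_, ?_, ?_, ?_, ?_, ?_, ?_, ?_, ?_, ?_, ?_⟩ <;> ext1 <;>
    simp [EmbAlg.mul_def, EmbAlg.add_def, EmbAlg.neg_def, EmbAlg.zero_def]

/-- The representative of an element of `EmbQuot K d`. -/
noncomputable def embLift {d : ℕ} (p : EmbQuot K d) : PolyRing K :=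
  embBaseMap K p.one + embBaseMap K p.s * s + embBaseMap K p.f * f + embBaseMap K p.c * c₃ +
    embBaseMap K p.e * c₄ + embBaseMap K p.sf * (s * f) + embBaseMap K p.fc * (f * c₃) +
    embBaseMap K p.ce * (c₃ * c₄)

theorem embLift_add {d : ℕ} (p q : EmbQuot K d) : embLift (p + q) = embLift p + embLift q := by
  simp only [embLift, EmbAlg.add_def, map_add]
  ring

/-- Compatibility with multiplication by the image of one variable suffices for an induction on
polynomials, so `embLift` need not be shown multiplicative in general. The relations derived below
reproduce the multiplication table of `EmbAlg` inside the quotient. -/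
theorem mk_embLift_mul_embVar {d : ℕ} (p : EmbQuot K d) (v : Var) :
    Ideal.Quotient.mk (compEmbedded K d) (embLift (p * embVar d v)) =
      Ideal.Quotient.mk _ (embLift p) * Ideal.Quotient.mk _ (X v) := by
  obtain ⟨h1, h2, hss, hff, h5, h6, h7, hcc, hee, h10, h11, h12, h13⟩ :=
    (compEmbedded_le_ker_iff _ _).1 (Ideal.mk_ker (I := compEmbedded K d)).ge
  obtain ⟨p₀, ps, pf, pc, pe, psf, pfc, pce⟩ := p
  have hx : embBaseMap K (X false) = b₃ := by simp [embBaseMap]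
  have hy : embBaseMap K (X true) = b₄ := by simp [embBaseMap]
  set g := Ideal.Quotient.mk (compEmbedded K d)
  have hsc : g s * g c₃ = g b₃ ^ d * (g f * g c₃) := by linear_combination h6
  have hfe : g f * g c₄ = g b₃ ^ d * (g f * g c₃) := by linear_combination h6 - h7
  have hse : g s * g c₄ = g b₃ ^ d * g b₄ ^ d * (g f * g c₃) := by
    linear_combination h5 + g b₄ ^ d * hfe
  have hsfc : g s * g f * g c₃ = 0 := by
    linear_combination g f * hsc + g b₃ ^ d * g c₃ * hff
  have hsce : g s * g c₃ * g c₄ = 0 := by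
    linear_combination g c₄ * hsc + g b₃ ^ d * g c₃ * hfe + (g b₃ ^ d) ^ 2 * g f * hcc
  have hsfe : g s * g f * g c₄ = 0 := by
    linear_combination g s * hfe + g b₃ ^ d * hsfc
  have hfce : g f * g c₃ * g c₄ = 0 := by
    linear_combination g c₃ * hfe + g b₃ ^ d * g f * hcc
  rw [sub_eq_zero] at h1 h2 h10 h11 h12 h13
  cases v <;> try simp only [h1, h2, h10, h11, h12, h13]
  all_goals
    simp only [embVar, embLift, EmbAlg.mul_def, EmbAlg.ofBase_apply, map_add, map_mul, map_zero,
      map_one, map_pow, hx, hy]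
  case s =>
    linear_combination (-g (embBaseMap K ps)) * hss - g (embBaseMap K pc) * hsc -
      g (embBaseMap K pe) * hse - g (embBaseMap K psf) * g f * hss -
      g (embBaseMap K pfc) * hsfc - g (embBaseMap K pce) * hsce
  case f =>
    linear_combination (-g (embBaseMap K pf)) * hff - g (embBaseMap K pe) * hfe -
      g (embBaseMap K psf) * g s * hff - g (embBaseMap K pfc) * g c₃ * hff -
      g (embBaseMap K pce) * hfce
  case c₂ | c₃ =>
    linear_combination (-g (embBaseMap K ps)) * hsc - g (embBaseMap K pc) * hcc -
      g (embBaseMap K psf) * hsfc - g (embBaseMap K pfc) * g f * hcc -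
      g (embBaseMap K pce) * g c₄ * hcc
  case c₁ | c₄ =>
    linear_combination (-g (embBaseMap K ps)) * hse - g (embBaseMap K pf) * hfe -
      g (embBaseMap K pe) * hee - g (embBaseMap K psf) * hsfe - g (embBaseMap K pfc) * hfce -
      g (embBaseMap K pce) * g c₃ * hee
  case s₁ | f₁ =>
    linear_combination (-g (embBaseMap K p₀)) * hse - g (embBaseMap K ps) * g c₄ * hss -
      g (embBaseMap K pf) * hsfe - g (embBaseMap K pc) * hsce - g (embBaseMap K pe) * g s * hee -
      g (embBaseMap K psf) * g f * g c₄ * hss - g (embBaseMap K pfc) * g s * hfce -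
      g (embBaseMap K pce) * g c₄ * hsce
  all_goals ring

theorem mk_embLift_embMap (d : ℕ) (r : PolyRing K) :
    Ideal.Quotient.mk (compEmbedded K d) (embLift (embMap K d r)) = Ideal.Quotient.mk _ r := by
  induction r using MvPolynomial.induction_on with
  | C a => simp [embMap, embLift, embBaseMap, EmbAlg.ofBase_apply]
  | add p q hp hq => rw [map_add, embLift_add, map_add, map_add, hp, hq]
  | mul_X p v hp => rw [map_mul, embMap_X, mk_embLift_mul_embVar, hp, map_mul]

theorem compEmbedded_eq_ker (d : ℕ) : compEmbedded K d = RingHom.ker (embMap K d) := by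
  refine le_antisymm (compEmbedded_le_ker_embMap d) fun r hr => ?_
  rw [← Ideal.Quotient.eq_zero_iff_mem, ← mk_embLift_embMap, (RingHom.mem_ker).1 hr]
  simp [embLift, EmbAlg.zero_def]

theorem compEmbedded_isPrimary (d : ℕ) : (compEmbedded K d).IsPrimary := by
  rw [compEmbedded_eq_ker, RingHom.ker]
  exact EmbAlg.isPrimary_bot.comap _

/-- The fc-coefficient of the image is x(y - x), with x and y the d-th powers of the two variables;
it is nonzero at the point where they take the values 1 and 0. -/
theorem notMem_compEmbedded {d : ℕ} (hd : 0 < d) :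
    s * c₂ * (b₁ ^ d - b₂ ^ d) ∉ compEmbedded K d := by
  rw [compEmbedded_eq_ker, RingHom.mem_ker]
  intro h
  have := congrArg EmbAlg.fc h
  simp only [map_mul, map_sub, map_pow, embMap_X, embVar] at this
  simp [EmbAlg.ofBase_apply, EmbAlg.mul_def, EmbAlg.add_def, EmbAlg.neg_def, sub_eq_add_neg,
    EmbAlg.zero_def] at this
  have h2 := congrArg (MvPolynomial.eval (fun b : Bool => if b then (0 : K) else 1)) this
  simp [hd.ne'] at h2

/-! ### The reduction steps modulo J. -/

theorem mul_mem_of_mem_span {R : Type*} [CommRing R] {T : Set R} {I : Ideal R} {a : R}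
    (h : ∀ y ∈ T, a * y ∈ I) {x : R} (hx : x ∈ Ideal.span T) : a * x ∈ I := by
  have : Ideal.span T ≤ Submodule.comap (LinearMap.mulLeft R a) I := Ideal.span_le.2 h
  exact this hx

/-- For x = Σ aₜt one has x - ρ x = Σ (aₜ - ρ aₜ)t, and aₜ - ρ aₜ ∈ ker ρ because ρ is idempotent.
When ρ x = 0 this turns an intersection of ideals into a product, which can be checked on pairs of
generators. -/
theorem sub_map_mem_span_mul_ker {R : Type*} [CommRing R] (ρ : R →+* R)
    (hρ : ρ.comp ρ = ρ) {T : Set R} (hT : ∀ t ∈ T, ρ t = t) {x : R} (hx : x ∈ Ideal.span T) :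
    x - ρ x ∈ Ideal.span T * RingHom.ker ρ := by
  induction hx using Submodule.span_induction with
  | mem t ht => simp [hT t ht]
  | zero => simp
  | add x y _ _ hx hy =>
    rw [map_add, add_sub_add_comm]
    exact add_mem hx hy
  | smul a x hx ih =>
    have ha : a - ρ a ∈ RingHom.ker ρ := by
      have := RingHom.congr_fun hρ a
      rw [RingHom.mem_ker, map_sub, sub_eq_zero]
      exact this.symm
    rw [smul_eq_mul, map_mul, show a * x - ρ a * ρ x = x * (a - ρ a) + ρ a * (x - ρ x) by ring]
    exact add_mem (Ideal.mul_mem_mul hx ha) (Ideal.mul_mem_left _ _ ih)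

theorem span_inf_ker_le_mul {R : Type*} [CommRing R] (ρ : R →+* R)
    (hρ : ρ.comp ρ = ρ) {T : Set R} (hT : ∀ t ∈ T, ρ t = t) :
    Ideal.span T ⊓ RingHom.ker ρ ≤ Ideal.span T * RingHom.ker ρ := fun x hx => by
  simpa [RingHom.mem_ker.1 hx.2] using sub_map_mem_span_mul_ker ρ hρ hT hx.1

theorem aeval_comp_self (v : Var → PolyRing K) (h : ∀ x, aeval v (v x) = v x) :
    (aeval v : PolyRing K →ₐ[K] PolyRing K).toRingHom.comp
      (aeval v : PolyRing K →ₐ[K] PolyRing K).toRingHom =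
    (aeval v : PolyRing K →ₐ[K] PolyRing K).toRingHom := by
  have : (aeval v : PolyRing K →ₐ[K] PolyRing K).comp (aeval v) = aeval v := by
    ext x : 1
    simpa using h x
  exact congrArg AlgHom.toRingHom this

theorem compC_inf_compSF_le (d : ℕ) :
    compC K ⊓ compSF K ≤ firstMayrMeyerIdeal K d ⊔ Ideal.span {f * c₂, f * c₃} := by
  set I := firstMayrMeyerIdeal K d ⊔ Ideal.span {f * c₂, f * c₃}
  obtain ⟨h1, h2, h3, h4, h5, h6, h7, h8, h9, h10, h11⟩ :=
    (firstMayrMeyerIdeal_le_ker_iff (Ideal.Quotient.mk I) d).1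
      (le_sup_left.trans (Ideal.mk_ker (I := I)).ge)
  have hI : Ideal.span {f * c₂, f * c₃} ≤ RingHom.ker (Ideal.Quotient.mk I) :=
    le_sup_right.trans (Ideal.mk_ker (I := I)).ge
  simp only [Ideal.span_le, Set.insert_subset_iff, Set.singleton_subset_iff,
    SetLike.mem_coe, RingHom.mem_ker, map_mul] at hI
  obtain ⟨k2, k3⟩ := hI
  obtain ⟨r1, r3, r4, q1, q4, t2, -⟩ := derived_relations h3 h4 h5 h6 h7 h8 h9 h10 h11
  rw [k2, zero_mul] at t2
  rw [← t2] at r1 r3 r4 q1 q4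
  rw [zero_mul] at r1 r4
  rw [r1, sub_zero] at h1
  rw [r4, sub_zero] at h2
  set T : Set (PolyRing K) := {c₁, c₂, c₃, c₄}
  have hprod : Ideal.span T * compSF K ≤ I := by
    rw [compSF, Ideal.span_mul_span', Ideal.span_le]
    rintro _ ⟨a, ha, b, hb, rfl⟩
    rw [SetLike.mem_coe, ← Ideal.Quotient.eq_zero_iff_mem]
    rcases hb with rfl | rfl | rfl | rfl <;> rcases ha with rfl | rfl | rfl | rfl <;>
      simp only [map_mul, map_sub, h1, h2, sub_zero, mul_zero, mul_comm _ (Ideal.Quotient.mk I s),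
        mul_comm _ (Ideal.Quotient.mk I f), r1, r3, r4, q1, q4, k2, k3, ← t2]
  rintro x ⟨hxC, hxSF⟩
  have hC : compC K ≤ Ideal.span {s₁ - s * c₁, f₁ - s * c₄} ⊔ Ideal.span T := by
    rw [← Ideal.span_union, compC]
    refine Ideal.span_mono ?_
    intro y
    simp [T]
    tauto
  -- The part l from s₁ - sc₁ and f₁ - sc₄ already lies in J; the rest w lies in (c₁, c₂, c₃, c₄) ∩
  -- `compSF`, which is a product since `substSF` fixes the cⱼ.
  obtain ⟨l, hl, w, hw, rfl⟩ := Submodule.mem_sup.1 (hC hxC)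
  have hlSF : l ∈ compSF K := Ideal.span_mono (by intro y; simp; tauto) hl
  have hlJ : l ∈ I := Submodule.mem_sup_left (Ideal.span_mono (by intro y; simp; tauto) hl)
  refine add_mem hlJ (hprod ?_)
  have hwSF : w ∈ compSF K := (add_mem_cancel_left hlSF).1 hxSF
  rw [compSF_eq_ker] at hwSF ⊢
  refine span_inf_ker_le_mul _ (aeval_comp_self _ ?_) ?_ ⟨hw, hwSF⟩
  · rintro (_ | _) <;> simp [substSF]
  · simp [T, substSF]

/-- The substitution killing `c₂` and `c₃`. -/
noncomputable def substC₂₃ : Var → PolyRing K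
  | .c₂ => 0 | .c₃ => 0 | v => X v

theorem span_c₂_c₃_eq_ker :
    Ideal.span {c₂, c₃} =
      RingHom.ker (aeval substC₂₃ : PolyRing K →ₐ[K] PolyRing K).toRingHom := by
  set I : Ideal (PolyRing K) := Ideal.span {c₂, c₃}
  have h2 : Ideal.Quotient.mk I c₂ = 0 :=
    Ideal.Quotient.eq_zero_iff_mem.2 (Ideal.subset_span (by simp))
  have h3 : Ideal.Quotient.mk I c₃ = 0 :=
    Ideal.Quotient.eq_zero_iff_mem.2 (Ideal.subset_span (by simp))
  refine eq_ker_aeval _ ?_ ?_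
  · rintro (_ | _) <;> simp [substC₂₃, *]
  · simp [I, Ideal.span_le, Set.insert_subset_iff, substC₂₃]

theorem mul_mem_of_mem_compQuadric {d : ℕ} {w : PolyRing K} (hw : w ∈ compQuadric K d)
    (hw' : w ∈ Ideal.span {c₂, c₃}) :
    f * w ∈ firstMayrMeyerIdeal K d ⊔ Ideal.span {s * c₂, f * c₃ * (b₂ - b₃)} := by
  set I := firstMayrMeyerIdeal K d ⊔ Ideal.span {s * c₂, f * c₃ * (b₂ - b₃)}
  obtain ⟨h1, h2, h3, h4, h5, h6, h7, h8, h9, h10, h11⟩ :=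
    (firstMayrMeyerIdeal_le_ker_iff (Ideal.Quotient.mk I) d).1
      (le_sup_left.trans (Ideal.mk_ker (I := I)).ge)
  have hI : Ideal.span {s * c₂, f * c₃ * (b₂ - b₃)} ≤ RingHom.ker (Ideal.Quotient.mk I) :=
    le_sup_right.trans (Ideal.mk_ker (I := I)).ge
  simp only [Ideal.span_le, Set.insert_subset_iff, Set.singleton_subset_iff,
    SetLike.mem_coe, RingHom.mem_ker, map_mul, map_sub] at hI
  obtain ⟨k2, k3⟩ := hI
  obtain ⟨r1, r3, r4, q1, q4, t2, t3, -⟩ := derived_relations h3 h4 h5 h6 h7 h8 h9 h10 h11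
  rw [k2] at r1 r3 r4 q1 q4 t2 t3
  set T : Set (PolyRing K) := {s₁ - s * c₁, f₁ - s * c₄, s, c₁, c₄, b₃ ^ d, b₂ - b₃}
  have hT : compQuadric K d ≤ Ideal.span T ⊔ Ideal.span {c₂ * b₁ - c₃ * b₄} := by
    rw [← Ideal.span_union, compQuadric]
    refine Ideal.span_mono ?_
    intro y
    simp [T]
    tauto
  obtain ⟨l, hl, z, hz, rfl⟩ := Submodule.mem_sup.1 (hT hw)
  -- The quadric c₂b₁ - c₃b₄ is split off: it lies in (c₂, c₃) already and f times it is a generator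
  -- of J. The other generators are fixed by c₂, c₃ ↦ 0, so intersecting them with (c₂, c₃) gives a
  -- product.
  have hz' : z ∈ Ideal.span {c₂, c₃} := by
    refine (Ideal.span_singleton_le_iff_mem _).2 ?_ hz
    exact sub_mem (Ideal.mul_mem_right _ _ (Ideal.subset_span (by simp)))
      (Ideal.mul_mem_right _ _ (Ideal.subset_span (by simp)))
  have hl' : l ∈ Ideal.span T * Ideal.span {c₂, c₃} := by
    have hl2 := (add_mem_cancel_right hz').1 hw'
    rw [span_c₂_c₃_eq_ker] at hl2 ⊢
    refine span_inf_ker_le_mul _ (aeval_comp_self _ ?_) ?_ ⟨hl, hl2⟩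
    · rintro (_ | _) <;> simp [substC₂₃]
    · simp [T, substC₂₃]
  rw [mul_add]
  refine add_mem ?_ (mul_mem_of_mem_span ?_ hz)
  · rw [Ideal.span_mul_span'] at hl'
    refine mul_mem_of_mem_span ?_ hl'
    rintro _ ⟨a, ha, b, hb, rfl⟩
    rw [← Ideal.Quotient.eq_zero_iff_mem]
    set g := Ideal.Quotient.mk I
    rcases hb with rfl | rfl <;> rcases ha with rfl | rfl | rfl | rfl | rfl | rfl | rfl <;>
      simp only [map_mul, map_sub, map_pow, h1, h2, mul_zero, zero_mul]
    · linear_combination g f * k2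
    · linear_combination g c₂ * q1
    · linear_combination g c₂ * q4
    · linear_combination t2
    · linear_combination h11
    · linear_combination g f * r3
    · linear_combination g c₃ * q1
    · linear_combination g c₃ * q4
    · linear_combination t3
    · linear_combination k3
  · rintro _ rfl
    rw [← Ideal.Quotient.eq_zero_iff_mem]
    simpa only [map_mul, map_sub] using h10

theorem mul_mem_of_mem_compB₄ {d : ℕ} {y : PolyRing K} (hy : y ∈ compB₄ K d) :
    f * c₃ * (b₂ - b₃) * y ∈ firstMayrMeyerIdeal K d := by
  set I := firstMayrMeyerIdeal K d
  obtain ⟨h1, h2, h3, h4, h5, h6, h7, h8, h9, h10, h11⟩ :=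
    (firstMayrMeyerIdeal_le_ker_iff (Ideal.Quotient.mk I) d).1 (Ideal.mk_ker (I := I)).ge
  obtain ⟨r1, r3, r4, q1, q4, t2, t3, t23, -⟩ :=
    derived_relations h3 h4 h5 h6 h7 h8 h9 h10 h11
  refine mul_mem_of_mem_span ?_ hy
  intro a ha
  rw [← Ideal.Quotient.eq_zero_iff_mem]
  set g := Ideal.Quotient.mk I
  rcases ha with rfl | rfl | rfl | rfl | rfl | rfl | rfl | rfl <;>
    simp only [map_mul, map_sub, map_pow, h1, h2, mul_zero]
  · linear_combination g f * (g b₂ - g b₃) * r3 + g f * t23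
  · linear_combination g c₃ * (g b₂ - g b₃) * q1 + g c₃ * t23
  · linear_combination g c₃ * h11
  · linear_combination g c₃ * (g b₂ - g b₃) * q4 + g c₃ * t23
  · linear_combination (g b₂ - g b₃) * t3 + t23
  · linear_combination g b₁ * h11 - (g b₂ - g b₃) * h10

theorem mul_sub_aeval_substRoot_mem {d : ℕ} (y : PolyRing K) :
    s * c₂ * (y - aeval (substRoot d) y) ∈ firstMayrMeyerIdeal K d := by
  set I := firstMayrMeyerIdeal K d
  obtain ⟨h1, h2, h3, h4, h5, h6, h7, h8, h9, h10, h11⟩ :=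
    (firstMayrMeyerIdeal_le_ker_iff (Ideal.Quotient.mk I) d).1 (Ideal.mk_ker (I := I)).ge
  obtain ⟨r1, r3, r4, q1, q4, t2, t3, t23, t14, t14d, -⟩ :=
    derived_relations h3 h4 h5 h6 h7 h8 h9 h10 h11
  -- Q is the colon ideal (J : sc₂). It is enough that each variable is congruent to its substitute
  -- modulo Q.
  let Q : Ideal (PolyRing K) := Submodule.comap (LinearMap.mulLeft (PolyRing K) (s * c₂)) I
  have hQ (z : PolyRing K) : z ∈ Q ↔ s * c₂ * z ∈ I := Iff.rfl
  suffices y - aeval (substRoot d) y ∈ Q from this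
  rw [← Ideal.Quotient.eq]
  refine (RingHom.congr_fun (mk_comp_eq_mk (I := Q) (substRoot d) fun v => ?_) y).symm
  rw [Ideal.Quotient.eq, hQ, ← Ideal.Quotient.eq_zero_iff_mem]
  set g := Ideal.Quotient.mk I
  have hs : g s * g c₂ * g s = g s * g c₂ * (g f * g b₁ ^ d) := by
    linear_combination (-g s) * q1 + g f * r1
  have hc1 : g s * g c₂ * g c₁ = g s * g c₂ * (g c₂ * g b₁ ^ d) := by
    linear_combination g c₂ * r1
  have hc4 : g s * g c₂ * g c₄ = g s * g c₂ * (g c₂ * g b₁ ^ d) := by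
    linear_combination g c₂ * r4 - g c₂ * t14d
  cases v <;> simp only [substRoot, map_mul, map_sub, map_pow, sub_self, map_zero, mul_zero]
  case s => linear_combination -hs
  case s₁ =>
    linear_combination (-g s * g c₂) * h1 - g c₁ * hs - g f * g b₁ ^ d * hc1
  case f₁ =>
    linear_combination (-g s * g c₂) * h2 - g c₄ * hs - g f * g b₁ ^ d * hc4
  case c₁ => linear_combination -hc1
  case c₃ => linear_combination (- g c₂) * r3
  case c₄ => linear_combination -hc4
  case b₃ => linear_combination t23
  case b₄ => linear_combination t14

theorem mul_mem_of_mem_embeddedPrime {d : ℕ} {y : PolyRing K} (hy : y ∈ embeddedPrime K) :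
    s * c₂ * (b₁ ^ d - b₂ ^ d) * y ∈ firstMayrMeyerIdeal K d := by
  set I := firstMayrMeyerIdeal K d
  obtain ⟨h1, h2, h3, h4, h5, h6, h7, h8, h9, h10, h11⟩ :=
    (firstMayrMeyerIdeal_le_ker_iff (Ideal.Quotient.mk I) d).1 (Ideal.mk_ker (I := I)).ge
  obtain ⟨r1, r3, r4, q1, q4, t2, t3, t23, t14, t14d, e2⟩ :=
    derived_relations h3 h4 h5 h6 h7 h8 h9 h10 h11
  refine mul_mem_of_mem_span ?_ hy
  intro a ha
  rw [← Ideal.Quotient.eq_zero_iff_mem]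
  set g := Ideal.Quotient.mk I
  have hs : g s * g c₂ * g s = g s * g c₂ * (g f * g b₁ ^ d) := by
    linear_combination (-g s) * q1 + g f * r1
  -- Two evaluations of s²c₂ are compared: sc₂fb₁^d and s·fc₂b₂^d. The next identity compares two
  -- evaluations of sc₁c₂ in the same way.
  have hf : g s * g c₂ * (g b₁ ^ d - g b₂ ^ d) * g f = 0 := by
    linear_combination -hs - g s * e2
  have hc2 : g s * g c₂ * (g b₁ ^ d - g b₂ ^ d) * g c₂ = 0 := by
    linear_combination (-g c₂) * r1 + g c₁ * h4 + g c₂ * g b₂ ^ d * q1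
  have hc1 : g s * g c₂ * (g b₁ ^ d - g b₂ ^ d) * g c₁ = 0 := by
    linear_combination g c₂ * (g b₁ ^ d - g b₂ ^ d) * r1 + g b₁ ^ d * hc2
  have hc4 : g s * g c₂ * (g b₁ ^ d - g b₂ ^ d) * g c₄ = 0 := by
    linear_combination g c₂ * (g b₁ ^ d - g b₂ ^ d) * r4 + g b₄ ^ d * hc2
  rcases ha with rfl | rfl | rfl | rfl | rfl | rfl | rfl | rfl | rfl | rfl <;>
    simp only [map_mul, map_sub, map_pow, h1, h2, mul_zero]
  · linear_combination (g b₁ ^ d - g b₂ ^ d) * hs + g b₁ ^ d * hf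
  · exact hf
  · exact hc1
  · exact hc2
  · linear_combination g c₂ * (g b₁ ^ d - g b₂ ^ d) * r3 + hc2
  · exact hc4
  · linear_combination (g b₁ ^ d - g b₂ ^ d) * t23
  · linear_combination (g b₁ ^ d - g b₂ ^ d) * t14

/-! ### Roots of unity and the factorization of b₁^d - b₂^d. -/

theorem exists_isPrimitiveRoot_of_splits {K : Type*} [Field K] {p d : ℕ} [ExpChar K p]
    (hd : 0 < d) (hcop : d.Coprime p) (h : (Polynomial.X ^ d - 1 : Polynomial K).Splits) :
    ∃ ζ : K, IsPrimitiveRoot ζ d := by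
  have : NeZero d := ⟨hd.ne'⟩
  have hne : (d : K) ≠ 0 := by
    cases ‹ExpChar K p› with
    | zero => exact_mod_cast hd.ne'
    | prime hp =>
      rw [Ne, CharP.cast_eq_zero_iff K p]
      intro hdvd
      exact hp.one_lt.ne' (Nat.eq_one_of_dvd_coprimes hcop hdvd dvd_rfl)
  have hsep := Polynomial.X_pow_sub_one_separable_iff.2 hne
  have hcard := Polynomial.splits_iff_card_roots.1 h
  have hnd := Polynomial.nodup_roots hsep
  have hdeg : (Polynomial.X ^ d - 1 : Polynomial K).natDegree = d := by
    simpa using Polynomial.natDegree_X_pow_sub_C (R := K) (n := d) (r := 1)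
  rw [hdeg] at hcard
  refine (HasEnoughRootsOfUnity.of_card_le (R := K) (n := d) ?_).prim
  classical
  rw [Nat.card_congr (rootsOfUnityEquivNthRoots K d), Nat.card_eq_fintype_card,
    Fintype.card_of_subtype (Polynomial.nthRootsFinset d (1 : K))]
  · rw [Polynomial.nthRootsFinset_def, Multiset.toFinset_card_of_nodup]
    · rw [Polynomial.nthRoots, map_one, hcard]
    · rwa [Polynomial.nthRoots, map_one]
  · intro x
    rw [Polynomial.mem_nthRootsFinset hd, Polynomial.mem_nthRoots hd]

/-- By Bézout 1 = da + nb, so α = α^(nb) and α^b is an n-th root. With n = p^e this writes every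
d'-th root of unity as β^(p^e). -/
theorem exists_pow_eq_of_pow_eq_one {K : Type*} [Field K] {d n : ℕ} (hcop : d.Coprime n)
    {α : K} (hd : 0 < d) (hα : α ^ d = 1) : ∃ β : K, β ^ n = α := by
  have hα0 : α ≠ 0 := by
    rintro rfl
    simp [hd.ne'] at hα
  refine ⟨α ^ (d.gcdB n), ?_⟩
  have h := Nat.gcd_eq_gcd_ab d n
  rw [hcop.gcd_eq_one, Nat.cast_one] at h
  calc (α ^ (d.gcdB n)) ^ n = α ^ ((n : ℤ) * d.gcdB n) := by
        rw [mul_comm, zpow_mul, zpow_natCast]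
    _ = (α ^ d) ^ (d.gcdA n) * α ^ ((n : ℤ) * d.gcdB n) := by rw [hα, one_zpow, one_mul]
    _ = α := by
      rw [← zpow_natCast α d, ← zpow_mul, ← zpow_add₀ hα0, ← h, zpow_one]

theorem isRelPrime_pow_sub {p e : ℕ} [ExpChar K p] {β γ : K} (h : β ≠ γ) :
    IsRelPrime (b₁ ^ p ^ e - C (β ^ p ^ e) * b₂ ^ p ^ e : PolyRing K)
      (b₁ ^ p ^ e - C (γ ^ p ^ e) * b₂ ^ p ^ e) := by
  have : ExpChar (PolyRing K) p := expChar_of_injective_ringHom (MvPolynomial.C_injective _ _) p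
  rw [map_pow, map_pow, ← mul_pow, ← mul_pow, ← sub_pow_expChar_pow, ← sub_pow_expChar_pow]
  refine IsRelPrime.pow ?_
  rw [(prime_X_sub_C_mul_X β).irreducible.isRelPrime_iff_not_dvd]
  intro hdvd
  have h2 := map_dvd (MvPolynomial.eval (fun v : Var => if v = .b₁ then β else 1)) hdvd
  simp [sub_eq_zero, h] at h2

/-- The polynomial b₁^d - b₂^d is the product of b₁^i - ηb₂^i over the d'-th roots of unity η, and
these factors are pairwise coprime. The roots of unity of the polynomial ring are constants, being
powers of ζ. -/
theorem b₁_pow_sub_b₂_pow_dvd {p e d' : ℕ} [ExpChar K p] {ζ : K} (hζ : IsPrimitiveRoot ζ d')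
    (hd' : 0 < d') (hcop : d'.Coprime p) {y : PolyRing K}
    (hy : ∀ α : K, α ^ d' = 1 → (b₁ ^ p ^ e - C α * b₂ ^ p ^ e) ∣ y) :
    b₁ ^ (d' * p ^ e) - b₂ ^ (d' * p ^ e) ∣ y := by
  have hCζ : IsPrimitiveRoot (C ζ : PolyRing K) d' :=
    hζ.map_of_injective (MvPolynomial.C_injective _ _)
  have hroot {η : PolyRing K} (h : η ∈ Polynomial.nthRootsFinset d' (1 : PolyRing K)) :
      ∃ β : K, (β ^ p ^ e) ^ d' = 1 ∧ η = C (β ^ p ^ e) := by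
    have : NeZero d' := ⟨hd'.ne'⟩
    obtain ⟨k, -, rfl⟩ := hCζ.eq_pow_of_pow_eq_one ((Polynomial.mem_nthRootsFinset hd' _).1 h)
    have hk : (ζ ^ k) ^ d' = 1 := by rw [← pow_mul, mul_comm, pow_mul, hζ.pow_eq_one, one_pow]
    obtain ⟨β, hβ⟩ := exists_pow_eq_of_pow_eq_one (hcop.pow_right e) hd' hk
    exact ⟨β, by rw [hβ, hk], by rw [hβ, map_pow]⟩
  rw [mul_comm d', pow_mul, pow_mul, hCζ.pow_sub_pow_eq_prod_sub_mul _ _ hd']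
  refine Finset.prod_dvd_of_isRelPrime ?_ ?_
  · intro η hη θ hθ hne
    obtain ⟨β, -, rfl⟩ := hroot hη
    obtain ⟨γ, -, rfl⟩ := hroot hθ
    exact isRelPrime_pow_sub fun h => hne (by rw [h])
  · intro η hη
    obtain ⟨β, h1, rfl⟩ := hroot hη
    exact hy _ h1

/-! ### Points separating the components, and the radical of the embedded one. -/

theorem radical_le_ker {R S : Type*} [CommRing R] [CommRing S] [IsDomain S] {I : Ideal R}
    {g : R →+* S} (h : I ≤ RingHom.ker g) : I.radical ≤ RingHom.ker g :=
  ((RingHom.ker_isPrime g).radical_le_iff).2 h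

/-- A point of `compC` on no other component. -/
def pointC : Var → K
  | .s => 1 | .f => 1 | .b₁ => 1 | _ => 0

/-- A point of `compSF` on no other component. -/
def pointSF : Var → K
  | .c₁ => 1 | .b₁ => 1 | _ => 0

/-- A point of `compB₄` on no other component. -/
def pointB₄ : Var → K
  | .f => 1 | .c₃ => 1 | .b₂ => 1 | _ => 0

/-- A point of `compQuadric` on no other component. -/
def pointQuadric : Var → K
  | .f => 1 | .c₂ => 1 | .b₄ => 1 | _ => 0

/-- A point of `compRoot d i (β ^ i)` on no other component. -/
def pointRoot (β : K) : Var → K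
  | .b₁ => β | .b₄ => β | _ => 1

theorem compC_radical_le :
    (compC K).radical ≤ RingHom.ker (MvPolynomial.eval (pointC : Var → K)) :=
  radical_le_ker ((compC_le_ker_iff _).2 (by simp [pointC]))

theorem compSF_radical_le :
    (compSF K).radical ≤ RingHom.ker (MvPolynomial.eval (pointSF : Var → K)) :=
  radical_le_ker ((compSF_le_ker_iff _).2 (by simp [pointSF]))

theorem compB₄_radical_le {d : ℕ} (hd : 0 < d) :
    (compB₄ K d).radical ≤ RingHom.ker (MvPolynomial.eval (pointB₄ : Var → K)) :=
  radical_le_ker ((compB₄_le_ker_iff _ _).2 (by simp [pointB₄, hd.ne']))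

theorem compQuadric_radical_le {d : ℕ} (hd : 0 < d) :
    (compQuadric K d).radical ≤ RingHom.ker (MvPolynomial.eval (pointQuadric : Var → K)) :=
  radical_le_ker ((compQuadric_le_ker_iff _ _).2 (by simp [pointQuadric, hd.ne']))

theorem compRoot_radical_le {d i : ℕ} {β : K} (hβ : β ^ d = 1) :
    (compRoot d i (β ^ i)).radical ≤ RingHom.ker (MvPolynomial.eval (pointRoot β)) :=
  radical_le_ker ((compRoot_le_ker_iff _ _ _ _).2 (by simp [pointRoot, hβ]))

theorem mem_of_mul_mem_of_isPrimary {R : Type*} [CommRing R] {I : Ideal R} (hI : I.IsPrimary)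
    {a y : R} (ha : a ∉ I.radical) (h : a * y ∈ I) : y ∈ I :=
  ((Ideal.isPrimary_iff.1 hI).2 (mul_comm a y ▸ h)).resolve_right ha

theorem compEmbedded_radical (d : ℕ) : (compEmbedded K d).radical = embeddedPrime K := by
  refine le_antisymm (embeddedPrime_isPrime.radical_le_iff.2 (compEmbedded_le_embeddedPrime d)) ?_
  have sub {y : PolyRing K} (h : y ∈ compEmbedded K d) : y ∈ (compEmbedded K d).radical :=
    Ideal.le_radical h
  have h3 : c₃ ∈ (compEmbedded K d).radical := ⟨2, Ideal.subset_span (by simp)⟩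
  have h4 : c₄ ∈ (compEmbedded K d).radical := ⟨2, Ideal.subset_span (by simp)⟩
  rw [embeddedPrime, Ideal.span_le]
  rintro y (rfl | rfl | rfl | rfl | rfl | rfl | rfl | rfl | rfl | rfl)
  · exact sub (Ideal.subset_span (by simp))
  · exact sub (Ideal.subset_span (by simp))
  · exact ⟨2, Ideal.subset_span (by simp)⟩
  · exact ⟨2, Ideal.subset_span (by simp)⟩
  · have := add_mem (sub (y := c₁ - c₄) (Ideal.subset_span (by simp))) h4
    rwa [sub_add_cancel] at this
  · have := add_mem (sub (y := c₂ - c₃) (Ideal.subset_span (by simp))) h3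
    rwa [sub_add_cancel] at this
  · exact h3
  · exact h4
  · exact sub (Ideal.subset_span (by simp))
  · exact sub (Ideal.subset_span (by simp))

/-! ### The reverse inclusion. -/

/-- The intersection of the components is contained in the first Mayr–Meyer ideal. -/
theorem mem_firstMayrMeyerIdeal {p d d' e : ℕ} [ExpChar K p] (hd : 0 < d)
    (hdi : d = d' * p ^ e) (hcop : d'.Coprime p) {ζ : K} (hζ : IsPrimitiveRoot ζ d')
    {x : PolyRing K} (hC : x ∈ compC K) (hSF : x ∈ compSF K) (hB₄ : x ∈ compB₄ K d)
    (hQ : x ∈ compQuadric K d) (hR : ∀ α : K, α ^ d' = 1 → x ∈ compRoot d (p ^ e) α)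
    (hE : x ∈ compEmbedded K d) : x ∈ firstMayrMeyerIdeal K d := by
  have hd' : 0 < d' := Nat.pos_of_ne_zero (by rintro rfl; simp [hdi] at hd)
  set J := firstMayrMeyerIdeal K d
  have step {I : Ideal (PolyRing K)} (hI : J ≤ I) {a b : PolyRing K} (ha : a ∈ J)
      (hx : a + b = x) (h : x ∈ I) : b ∈ I := by
    rw [← hx] at h
    exact (add_mem_cancel_left (hI ha)).1 h
  obtain ⟨t, e', ht⟩ : ∃ t e', x - (s * c₂ * t + f * c₃ * (b₂ - b₃) * e') ∈ J := by
    obtain ⟨j, hj, r, hr, hx⟩ := Submodule.mem_sup.1 (compC_inf_compSF_le d ⟨hC, hSF⟩)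
    obtain ⟨u, v, rfl⟩ := Ideal.mem_span_pair.1 hr
    have hfw : u * (f * c₂) + v * (f * c₃) = f * (u * c₂ + v * c₃) := by ring
    rw [hfw] at hx
    -- Since f is nonzero at `pointQuadric`, it is outside the radical of `compQuadric` and can be
    -- cancelled.
    have hw := mem_of_mul_mem_of_isPrimary (compQuadric_isPrimary (K := K) hd) (a := f)
      (fun h => by
        have := compQuadric_radical_le (K := K) hd h
        simp [pointQuadric] at this)
      (step (firstMayrMeyerIdeal_le_compQuadric d) hj hx hQ)
    have := mul_mem_of_mem_compQuadric hw (Ideal.mem_span_pair.2 ⟨u, v, rfl⟩)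
    obtain ⟨j', hj', r, hr, hx'⟩ := Submodule.mem_sup.1 this
    obtain ⟨t, e', rfl⟩ := Ideal.mem_span_pair.1 hr
    refine ⟨t, e', ?_⟩
    rw [← hx, ← hx']
    convert add_mem hj hj' using 1
    ring
  -- The term sc₂t is in `compB₄` because s is, and fc₃(b₂ - b₃) is nonzero at `pointB₄`; hence e' ∈
  -- `compB₄`.
  have he : f * c₃ * (b₂ - b₃) * e' ∈ J := by
    refine mul_mem_of_mem_compB₄ (mem_of_mul_mem_of_isPrimary (compB₄_isPrimary hd)
      (a := f * c₃ * (b₂ - b₃)) (fun h => ?_) ?_)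
    · have := compB₄_radical_le hd h
      simp [pointB₄] at this
    · have h1 := step (firstMayrMeyerIdeal_le_compB₄ d) ht (sub_add_cancel _ _) hB₄
      refine (add_mem_cancel_left (Ideal.mul_mem_right _ _ (Ideal.mul_mem_right _ _ ?_))).1 h1
      exact Ideal.subset_span (by simp)
  have ht' : x - s * c₂ * t ∈ J := by
    convert add_mem ht he using 1
    ring
  -- As sc₂ is nonzero at `pointRoot β`, t itself lies in every root component, so its substitute is
  -- divisible by every b₁^i - αb₂^i.
  have hdvd : (b₁ ^ d - b₂ ^ d : PolyRing K) ∣ aeval (substRoot d) t := by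
    rw [hdi]
    refine b₁_pow_sub_b₂_pow_dvd hζ hd' hcop fun α hα => ?_
    rw [← hdi]
    obtain ⟨β, rfl⟩ := exists_pow_eq_of_pow_eq_one (hcop.pow_right e) hd' hα
    have hβ : β ^ d = 1 := by rw [hdi, mul_comm, pow_mul, hα]
    have := mem_of_mul_mem_of_isPrimary (compRoot_isPrimary β) (a := s * c₂) (fun h => by
        have := compRoot_radical_le hβ h
        simp [pointRoot] at this)
      (step (firstMayrMeyerIdeal_le_compRoot hdi hα) ht' (sub_add_cancel _ _) (hR _ hα))
    rw [compRoot_eq_comap] at this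
    exact Ideal.mem_span_singleton.1 this
  obtain ⟨y, hy⟩ := hdvd
  have hz : x - s * c₂ * (b₁ ^ d - b₂ ^ d) * y ∈ J := by
    convert add_mem ht' (mul_sub_aeval_substRoot_mem (d := d) t) using 1
    rw [hy]
    ring
  -- Here the coefficient is outside `compEmbedded` but need not be outside its radical, so
  -- primariness only yields y in the radical; that is enough.
  have hyE : y ∈ embeddedPrime K := by
    rw [← compEmbedded_radical d]
    have := step (firstMayrMeyerIdeal_le_compEmbedded d) hz (sub_add_cancel _ _) hE
    exact ((Ideal.isPrimary_iff.1 (compEmbedded_isPrimary d)).2 this).resolve_left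
      (notMem_compEmbedded hd)
  simpa using add_mem hz (mul_mem_of_mem_embeddedPrime hyE)

/-! ### Distinctness, counting and irredundancy of the components. -/

/-- Labels for the components of the first Mayr–Meyer ideal. -/
inductive CompLabel (K : Type*) : Type _
  | c | sf | b₄ | quadric | embedded
  | root (α : K)

/-- The component with a given label. -/
noncomputable def comp {K : Type*} [Field K] (d i : ℕ) : CompLabel K → Ideal (PolyRing K)
  | .c => compC K | .sf => compSF K | .b₄ => compB₄ K d | .quadric => compQuadric K d
  | .embedded => compEmbedded K d
  | .root α => compRoot d i α

/-- The labels of the components, with roots of unity of order dividing `n`. -/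
def CompLabel.IsValid {K : Type*} [Field K] (n : ℕ) : CompLabel K → Prop
  | .root α => α ^ n = 1
  | _ => True

/-- The containment puts the special point of l on the component m, and that point lies on no other
component. For roots, `pointRoot β` lies on `compRoot d i α` only when α = β^i. -/
theorem eq_of_comp_le_radical {p d d' e : ℕ} (hd : 0 < d)
    (hdi : d = d' * p ^ e) (hcop : d'.Coprime p) {l m : CompLabel K}
    (hl : l.IsValid d') (hl' : l ≠ .embedded)
    (h : comp d (p ^ e) m ≤ (comp d (p ^ e) l).radical) : m = l := by
  have hd' : 0 < d' := Nat.pos_of_ne_zero (by rintro rfl; simp [hdi] at hd)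
  obtain _ | _ | _ | _ | _ | α := l
  · replace h := h.trans compC_radical_le
    cases m <;> simp [comp, compC_le_ker_iff, compSF_le_ker_iff, compB₄_le_ker_iff,
      compQuadric_le_ker_iff, compEmbedded_le_ker_iff, compRoot_le_ker_iff, pointC] at h ⊢
  · replace h := h.trans compSF_radical_le
    cases m <;> simp [comp, compC_le_ker_iff, compSF_le_ker_iff, compB₄_le_ker_iff,
      compQuadric_le_ker_iff, compEmbedded_le_ker_iff, compRoot_le_ker_iff, pointSF] at h ⊢
  · replace h := h.trans (compB₄_radical_le hd)
    cases m <;> simp [comp, compC_le_ker_iff, compSF_le_ker_iff, compB₄_le_ker_iff,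
      compQuadric_le_ker_iff, compEmbedded_le_ker_iff, compRoot_le_ker_iff, pointB₄] at h ⊢
  · replace h := h.trans (compQuadric_radical_le hd)
    cases m <;> simp [comp, compC_le_ker_iff, compSF_le_ker_iff, compB₄_le_ker_iff,
      compQuadric_le_ker_iff, compEmbedded_le_ker_iff, compRoot_le_ker_iff, pointQuadric] at h ⊢
  · exact absurd rfl hl'
  · replace hl : α ^ d' = 1 := hl
    obtain ⟨β, rfl⟩ := exists_pow_eq_of_pow_eq_one (hcop.pow_right e) hd' hl
    replace h := h.trans (compRoot_radical_le (by rw [hdi, mul_comm, pow_mul, hl]))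
    cases m <;> simp [comp, compC_le_ker_iff, compSF_le_ker_iff, compB₄_le_ker_iff,
      compQuadric_le_ker_iff, compEmbedded_le_ker_iff, compRoot_le_ker_iff, pointRoot] at h ⊢
    exact (sub_eq_zero.1 h.2).symm

theorem firstMayrMeyerIdeal_le_comp {d d' i : ℕ} (hdi : d = d' * i) {l : CompLabel K}
    (hl : l.IsValid d') : firstMayrMeyerIdeal K d ≤ comp d i l := by
  cases l with
  | c => exact firstMayrMeyerIdeal_le_compC d
  | sf => exact firstMayrMeyerIdeal_le_compSF d
  | b₄ => exact firstMayrMeyerIdeal_le_compB₄ d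
  | quadric => exact firstMayrMeyerIdeal_le_compQuadric d
  | embedded => exact firstMayrMeyerIdeal_le_compEmbedded d
  | root α => exact firstMayrMeyerIdeal_le_compRoot hdi hl

theorem comp_isPrimary {p d d' e : ℕ} [ExpChar K p] (hd : 0 < d) (hd' : 0 < d')
    (hcop : d'.Coprime p) {l : CompLabel K} (hl : l.IsValid d') :
    (comp d (p ^ e) l).IsPrimary := by
  cases l with
  | c => exact compC_isPrime.isPrimary
  | sf => exact compSF_isPrime.isPrimary
  | b₄ => exact compB₄_isPrimary hd
  | quadric => exact compQuadric_isPrimary hd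
  | embedded => exact compEmbedded_isPrimary d
  | root α =>
    obtain ⟨β, rfl⟩ := exists_pow_eq_of_pow_eq_one (hcop.pow_right e) hd' hl
    exact compRoot_isPrimary β

/-- Together with `notMem_compEmbedded`, this shows that the embedded component cannot be omitted.
-/
theorem mul_mem_comp {d d' i : ℕ} (hdi : d = d' * i) {l : CompLabel K}
    (hl : l.IsValid d') (hl' : l ≠ .embedded) :
    s * c₂ * (b₁ ^ d - b₂ ^ d) ∈ comp d i l := by
  have hs {I : Ideal (PolyRing K)} (h : s ∈ I) : s * c₂ * (b₁ ^ d - b₂ ^ d) ∈ I :=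
    Ideal.mul_mem_right _ _ (Ideal.mul_mem_right _ _ h)
  cases l with
  | c => exact Ideal.mul_mem_right _ _ (Ideal.mul_mem_left _ _ (Ideal.subset_span (by simp)))
  | sf | b₄ | quadric => exact hs (Ideal.subset_span (by simp))
  | embedded => exact absurd rfl hl'
  | root α => exact Ideal.mul_mem_left _ _ (b₁_pow_sub_b₂_pow_mem_compRoot hdi hl)

theorem mem_minimalComponents_iff {d d' i : ℕ} (hd' : 0 < d') {Q : Ideal (PolyRing K)} :
    Q ∈ minimalComponents K d d' i ↔
      ∃ l : CompLabel K, l.IsValid d' ∧ l ≠ .embedded ∧ comp d i l = Q := by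
  simp only [minimalComponents, Finset.mem_union, Finset.mem_image, Finset.mem_insert,
    Finset.mem_singleton, Polynomial.mem_nthRootsFinset hd']
  constructor
  · rintro (⟨α, hα, rfl⟩ | rfl | rfl | rfl | rfl)
    · exact ⟨.root α, hα, by simp, rfl⟩
    · exact ⟨.c, trivial, by simp, rfl⟩
    · exact ⟨.sf, trivial, by simp, rfl⟩
    · exact ⟨.b₄, trivial, by simp, rfl⟩
    · exact ⟨.quadric, trivial, by simp, rfl⟩
  · rintro ⟨l, hl, hl', rfl⟩
    cases l with
    | root α => exact .inl ⟨α, hl, rfl⟩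
    | embedded => exact absurd rfl hl'
    | _ => simp [comp]

theorem card_minimalComponents {p d d' e : ℕ} (hd : 0 < d)
    (hdi : d = d' * p ^ e) (hcop : d'.Coprime p) {ζ : K} (hζ : IsPrimitiveRoot ζ d') :
    (minimalComponents K d d' (p ^ e)).card = d' + 4 := by
  have hd' : 0 < d' := Nat.pos_of_ne_zero (by rintro rfl; simp [hdi] at hd)
  have hinj {l m : CompLabel K} (hl : l.IsValid d') (hl' : l ≠ .embedded)
      (h : comp d (p ^ e) m = comp d (p ^ e) l) : m = l :=
    eq_of_comp_le_radical hd hdi hcop hl hl' (h.le.trans Ideal.le_radical)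
  have h4 : ({compC K, compSF K, compB₄ K d, compQuadric K d} :
      Finset (Ideal (PolyRing K))).card = 4 := by
    rw [Finset.card_insert_of_notMem, Finset.card_insert_of_notMem, Finset.card_pair]
    · intro h
      simpa using hinj (l := .b₄) (m := .quadric) trivial (by simp) h.symm
    · simp only [Finset.mem_insert, Finset.mem_singleton]
      rintro (h | h)
      · simpa using hinj (l := .sf) (m := .b₄) trivial (by simp) h.symm
      · simpa using hinj (l := .sf) (m := .quadric) trivial (by simp) h.symm
    · simp only [Finset.mem_insert, Finset.mem_singleton]
      rintro (h | h | h)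
      · simpa using hinj (l := .c) (m := .sf) trivial (by simp) h.symm
      · simpa using hinj (l := .c) (m := .b₄) trivial (by simp) h.symm
      · simpa using hinj (l := .c) (m := .quadric) trivial (by simp) h.symm
  rw [minimalComponents, Finset.card_union_of_disjoint, h4, Finset.card_image_of_injOn,
    hζ.card_nthRootsFinset]
  · intro α hα β hβ h
    have := hinj (l := .root β) (m := .root α)
      ((Polynomial.mem_nthRootsFinset hd' _).1 hβ) (by simp) h
    simpa using this
  · rw [Finset.disjoint_left]
    intro Q hQ hQ'
    obtain ⟨α, hα, rfl⟩ := Finset.mem_image.1 hQ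
    have hα' := (Polynomial.mem_nthRootsFinset hd' _).1 hα
    simp only [Finset.mem_insert, Finset.mem_singleton] at hQ'
    rcases hQ' with h | h | h | h
    · simpa using hinj (l := .root α) (m := .c) hα' (by simp) h.symm
    · simpa using hinj (l := .root α) (m := .sf) hα' (by simp) h.symm
    · simpa using hinj (l := .root α) (m := .b₄) hα' (by simp) h.symm
    · simpa using hinj (l := .root α) (m := .quadric) hα' (by simp) h.symm

/-- It strictly contains the prime `compSF`, since c₁ is nonzero at `pointSF`. -/
theorem embeddedPrime_notMem_minimalPrimes (d : ℕ) :
    embeddedPrime K ∉ (firstMayrMeyerIdeal K d).minimalPrimes := by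
  intro h
  have hle := h.2 ⟨compSF_isPrime, firstMayrMeyerIdeal_le_compSF d⟩ compSF_le_embeddedPrime
  have h1 := compSF_radical_le (Ideal.le_radical (hle (Ideal.subset_span (by simp) :
    c₁ ∈ embeddedPrime K)))
  simp [pointSF] at h1

end MayrMeyer

/-! ### The main theorem. -/

open MayrMeyer in
theorem theorem1 {K : Type*} [Field K] (p : ℕ) [ExpChar K p] (d d' i : ℕ) (hd : 0 < d)
    (hdi : d = d' * i) (hi : ∃ e : ℕ, i = p ^ e) (hcop : Nat.Coprime d' p)
    (hroots : (Polynomial.X ^ d' - 1 : Polynomial K).Splits) :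
    -- the displayed intersection
    MayrMeyer.firstMayrMeyerIdeal K d =
      MayrMeyer.compC K ⊓
      (⨅ α ∈ {α : K | α ^ d' = 1}, MayrMeyer.compRoot d i α) ⊓
      MayrMeyer.compSF K ⊓
      MayrMeyer.compB₄ K d ⊓
      MayrMeyer.compQuadric K d ⊓
      MayrMeyer.compEmbedded K d ∧
    -- it is a minimal primary decomposition
    Submodule.IsMinimalPrimaryDecomposition (MayrMeyer.firstMayrMeyerIdeal K d)
      (insert (MayrMeyer.compEmbedded K d) (MayrMeyer.minimalComponents K d d' i)) ∧
    -- there are `d' + 4` minimal components, belonging to the minimal primes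
    (MayrMeyer.minimalComponents K d d' i).card = d' + 4 ∧
    (∀ Q ∈ MayrMeyer.minimalComponents K d d' i,
      Q.radical ∈ (MayrMeyer.firstMayrMeyerIdeal K d).minimalPrimes) ∧
    -- the remaining component is embedded, with the stated radical
    (MayrMeyer.compEmbedded K d).radical = MayrMeyer.embeddedPrime K ∧
    MayrMeyer.embeddedPrime K ∉ (MayrMeyer.firstMayrMeyerIdeal K d).minimalPrimes := by
  obtain ⟨e, rfl⟩ := hi
  have hd' : 0 < d' := Nat.pos_of_ne_zero (by rintro rfl; simp [hdi] at hd)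
  obtain ⟨ζ, hζ⟩ := exists_isPrimitiveRoot_of_splits hd' hcop hroots
  have hmem {Q : Ideal (PolyRing K)} :
      Q ∈ insert (compEmbedded K d) (minimalComponents K d d' (p ^ e)) ↔
        ∃ l : CompLabel K, l.IsValid d' ∧ comp d (p ^ e) l = Q := by
    rw [Finset.mem_insert, mem_minimalComponents_iff hd']
    constructor
    · rintro (rfl | ⟨l, hl, -, rfl⟩)
      · exact ⟨.embedded, trivial, rfl⟩
      · exact ⟨l, hl, rfl⟩
    · rintro ⟨l, hl, rfl⟩
      by_cases hle : l = .embedded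
      · exact .inl (by rw [hle, comp])
      · exact .inr ⟨l, hl, hle, rfl⟩
  have hinf : (insert (compEmbedded K d) (minimalComponents K d d' (p ^ e))).inf id =
      firstMayrMeyerIdeal K d := by
    refine le_antisymm (fun x hx => ?_) (Finset.le_inf fun Q hQ => ?_)
    · rw [Submodule.mem_finsetInf] at hx
      have hx' {l : CompLabel K} (hl : l.IsValid d') : x ∈ comp d (p ^ e) l :=
        hx _ (hmem.2 ⟨l, hl, rfl⟩)
      exact mem_firstMayrMeyerIdeal hd hdi hcop hζ (hx' (l := .c) trivial)
        (hx' (l := .sf) trivial) (hx' (l := .b₄) trivial) (hx' (l := .quadric) trivial)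
        (fun α hα => hx' (l := .root α) hα) (hx' (l := .embedded) trivial)
    · obtain ⟨l, hl, rfl⟩ := hmem.1 hQ
      exact firstMayrMeyerIdeal_le_comp hdi hl
  refine ⟨?_, ⟨hinf, fun Q hQ => ?_, fun Q hQ Q' hQ' hne => ?_, fun Q hQ hle => ?_⟩,
    card_minimalComponents hd hdi hcop hζ, fun Q hQ => ?_, compEmbedded_radical d,
    embeddedPrime_notMem_minimalPrimes d⟩
  · refine le_antisymm ?_ ?_
    · have hle {l : CompLabel K} (hl : l.IsValid d') := firstMayrMeyerIdeal_le_comp hdi hl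
      refine le_inf (le_inf (le_inf (le_inf (le_inf (hle (l := .c) trivial)
        (le_iInf₂ fun α hα => hle (l := .root α) hα)) (hle (l := .sf) trivial))
        (hle (l := .b₄) trivial)) (hle (l := .quadric) trivial)) (hle (l := .embedded) trivial)
    · rintro x ⟨⟨⟨⟨⟨hC, hR⟩, hSF⟩, hB₄⟩, hQ⟩, hE⟩
      have hR' (α : K) (hα : α ^ d' = 1) : x ∈ compRoot d (p ^ e) α :=
        (iInf₂_le (f := fun α (_ : α ∈ {α : K | α ^ d' = 1}) => compRoot d (p ^ e) α) α hα) hR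
      exact mem_firstMayrMeyerIdeal hd hdi hcop hζ hC hSF hB₄ hQ hR' hE
  · obtain ⟨l, hl, rfl⟩ := hmem.1 hQ
    exact comp_isPrimary hd hd' hcop hl
  · obtain ⟨l, hl, rfl⟩ := hmem.1 hQ
    obtain ⟨m, hm, rfl⟩ := hmem.1 hQ'
    rw [Function.onFun, Submodule.colon_univ, Submodule.colon_univ]
    intro h
    -- Two different components cannot both be embedded, and separating the radicals needs only one
    -- non-embedded label.
    by_cases hle : l = .embedded
    · by_cases hme : m = .embedded
      · exact hne (by rw [hle, hme])
      · have := eq_of_comp_le_radical hd hdi hcop hm hme (Ideal.le_radical.trans h.le)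
        exact hne (by rw [this])
    · have := eq_of_comp_le_radical hd hdi hcop hl hle (Ideal.le_radical.trans h.ge)
      exact hne (by rw [this])
  · obtain ⟨l, hl, rfl⟩ := hmem.1 hQ
    by_cases hle' : l = .embedded
    · subst hle'
      refine notMem_compEmbedded hd (hle ?_)
      rw [Submodule.mem_finsetInf]
      intro Q hQ
      obtain ⟨hQne, hQ⟩ := Finset.mem_erase.1 hQ
      obtain ⟨m, hm, rfl⟩ := hmem.1 hQ
      exact mul_mem_comp hdi hm (by rintro rfl; exact hQne rfl)
    · have hprime := Ideal.isPrime_radical (comp_isPrimary (e := e) hd hd' hcop hl)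
      -- A prime containing the intersection of the remaining components contains one of them.
      obtain ⟨Q', hQ', hle2⟩ := hprime.inf_le'.1 (hle.trans Ideal.le_radical)
      obtain ⟨hne, hQ'⟩ := Finset.mem_erase.1 hQ'
      obtain ⟨m, hm, rfl⟩ := hmem.1 hQ'
      exact hne (by rw [eq_of_comp_le_radical hd hdi hcop hl hle' hle2])
  · obtain ⟨l, hl, hle, rfl⟩ := (mem_minimalComponents_iff hd').1 hQ
    have hprime := Ideal.isPrime_radical (comp_isPrimary (e := e) hd hd' hcop hl)
    refine ⟨⟨hprime, (firstMayrMeyerIdeal_le_comp hdi hl).trans Ideal.le_radical⟩, ?_⟩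
    rintro P ⟨hP, hJP⟩ hPl
    rw [← hinf] at hJP
    -- A prime P over J inside the radical of component l contains some component m; then m = l, so
    -- P contains that radical.
    obtain ⟨Q', hQ', hle2⟩ := hP.inf_le'.1 hJP
    obtain ⟨m, hm, rfl⟩ := hmem.1 hQ'
    have hml := eq_of_comp_le_radical hd hdi hcop hl hle (le_trans hle2 hPl)
    subst hml
    exact hP.radical_le_iff.2 hle2
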